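/- Let $\mathbb{H}$ be a stable proper rational filter with real coefficients (all poles in the open unit disc). Consider the stationary Gaussian channel $y(k)=u(k)+w(k)$, $k=0,1,2,\dots$, where $(w(k))$ is a zero-mean stationary Gaussian process with power spectral density $\mathbb{S}_w(e^{i\theta})=|\mathbb{H}(e^{i\theta})|^2$. Let $\mathbb{Q}$ be a stable, strictly causal (i.e. strictly proper) rational filter with real coefficients, and put $\mathbb{K}=-\mathbb{Q}(1+\mathbb{Q})^{-1}$. **Realization.** $\mathbb{K}$ has a real state-space realization $\mathbb{K}(z)=C(zI-A)^{-1}B$ with $A=\begin{pmatrix}A_s&0\\0&A_u\end{pmatrix}$, $B=\begin{pmatrix}B_s\\B_u\end{pmatrix}$, $C=(C_s\;\,C_u)$, in which all eigenvalues of $A_s$ lie in the open unit disc, all eigenvalues of $A_u\in\mathbb{R}^{m\times m}$ lie outside the open unit disc ($|\lambda|\ge 1$), $(A_u,B_u)$ is controllable and $(C_u,A_u)$ is observable. Fix any such realization, and let $\lambda_1(A_u),\dots,\lambda_m(A_u)$ be the eigenvalues of $A_u$ with multiplicity. **Coding scheme.** The decoder runs, from $x_s(0)=0$ and $\hat x_u(0)=0$,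 $$x_s(k+1)=A_sx_s(k)+B_sy(k),\qquad \hat x_u(k+1)=A_u\hat x_u(k)+B_uy(k),$$ and feeds back $\hat u(k)=C_sx_s(k)+C_u\hat x_u(k)$. The encoder, which holds the message as a vector $x_{u,0}\in\mathbb{R}^m$, forms $\tilde u_u(k)=C_uA_u^kx_{u,0}$ and sends $u(k)=-(\tilde u_u(k)+\hat u(k))$ (negative feedback). After $n$ channel uses the decoder's estimate of $x_{u,0}$ is $-A_u^{-n}\hat x_u(n)$. For an invertible matrix $P\in\mathbb{R}^{m\times m}$ and positive integers $N_1,\dots,N_m$, the messages are the $\prod_iN_i$ cells obtained by cutting the $i$-th side of the unit cube $[0,1]^m$ into $N_i$ equal pieces. A message is sent as $x_{u,0}=Pc$, where $c$ is the centre of its cell. The decoder applies $P^{-1}$ to its estimate and returns the cell that contains the result, where a coordinate outside $[0,1]$ is moved to the nearest cell. **Claim.** First, $\theta\mapsto\log_2|1+\mathbb{Q}(e^{i\theta})|$ is integrable on $[-\pi,\pi]$ and $$\frac1{2\pi}\int_{-\pi}^{\pi}\log_2|1+\mathbb{Q}(e^{i\theta})|\,d\theta=\sum_{i=1}^m\log_2|\lambda_i(A_u)|=:R^*.$$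 Second, the scheme reliably achieves the rate $R^*$ (bits per channel use) with doubly exponentially decaying error probability. That is, there is an invertible $P$ such that for every $R<R^*$ there are integers $N_i(n)$ with $\prod_iN_i(n)\ge2^{nR}$ for all $n$ and with the following two properties. 1. There are $a,b>0$ such that, for all large $n$, the error probability after $n$ channel uses, averaged over uniformly distributed messages, satisfies $P_e^{(n)}\le\exp(-a\,e^{bn})$. 2. The average power $\frac1n\sum_{k=0}^{n-1}E[u(k)^2]$ converges, as $n\to\infty$, to $\frac1{2\pi}\int_{-\pi}^{\pi}|\mathbb{Q}(e^{i\theta})|^2\,\mathbb{S}_w(e^{i\theta})\,d\theta$, uniformly over the messages. -/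

import Mathlib

open MeasureTheory ProbabilityTheory Filter Matrix

noncomputable section

namespace FeedbackCode

/-! ### Rational filters with real coefficients, as rational functions of `z` -/

/-- Stability: all poles lie in the open unit disc. -/
def IsStable (F : RatFunc ℝ) : Prop :=
  ∀ z : ℂ, F.denom.eval₂ (algebraMap ℝ ℂ) z = 0 → ‖z‖ < 1

/-- Proper, that is causal. -/
def IsProper (F : RatFunc ℝ) : Prop := F.num.degree ≤ F.denom.degree

/-- Strictly proper, that is strictly causal (at least one step of delay). -/
def IsStrictlyProper (F : RatFunc ℝ) : Prop := F.num.degree < F.denom.degree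

/-- The frequency response `F (e ^ (i θ))`. -/
def freqResponse (F : RatFunc ℝ) (θ : ℝ) : ℂ :=
  F.eval (algebraMap ℝ ℂ) (Complex.exp (θ * Complex.I))

/-- The power spectral density `|H (e ^ (i θ))| ^ 2` of the output of the filter `H` driven by
white noise of unit variance. -/
def spectralDensity (H : RatFunc ℝ) (θ : ℝ) : ℝ := ‖freqResponse H θ‖ ^ 2

/-- `W` is (a one-sided sample of) the zero-mean stationary Gaussian process with power spectral
density `|H| ^ 2`; since the density is even, the autocovariance at lag `i - j` is its cosine
coefficient. -/
structure IsStationaryGaussianNoise {Ω : Type*} [MeasurableSpace Ω] (H : RatFunc ℝ)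
    (W : ℕ → Ω → ℝ) (μ : Measure Ω) : Prop where
  gaussian : IsGaussianProcess W μ
  mean_zero : ∀ k, ∫ ω, W k ω ∂μ = 0
  cov_eq : ∀ i j : ℕ, covariance (W i) (W j) μ =
    (1 / (2 * Real.pi)) *
      ∫ θ in (-Real.pi)..Real.pi, Real.cos (((i : ℝ) - (j : ℝ)) * θ) * spectralDensity H θ

/-- The controller `K = - Q (1 + Q)⁻¹` with Youla parameter `Q` (for the plant `1`). -/
def controller (Q : RatFunc ℝ) : RatFunc ℝ := -Q * (1 + Q)⁻¹

/-! ### State-space realizations -/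

/-- The transfer function `C (z - A)⁻¹ B`. -/
def transfer {ι : Type*} [Fintype ι] [DecidableEq ι] (A : Matrix ι ι ℝ) (B C : ι → ℝ) :
    RatFunc ℝ :=
  (fun i => algebraMap ℝ (RatFunc ℝ) (C i)) ⬝ᵥ
    ((Matrix.scalar ι (RatFunc.X : RatFunc ℝ) - A.map (algebraMap ℝ (RatFunc ℝ)))⁻¹ *ᵥ
      fun i => algebraMap ℝ (RatFunc ℝ) (B i))

/-- The complex eigenvalues of a real matrix, with algebraic multiplicity. -/
def eigenvalues {m : ℕ} (A : Matrix (Fin m) (Fin m) ℝ) : Multiset ℂ :=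
  (A.map (algebraMap ℝ ℂ)).charpoly.roots

/-- A realization of the strictly proper system `K`, split into a strictly stable part and a part
with all eigenvalues outside the open unit disc, the latter without hidden (uncontrollable or
unobservable) modes. -/
structure Realization (K : RatFunc ℝ) (p m : ℕ) where
  As : Matrix (Fin p) (Fin p) ℝ
  Au : Matrix (Fin m) (Fin m) ℝ
  Bs : Fin p → ℝ
  Bu : Fin m → ℝ
  Cs : Fin p → ℝ
  Cu : Fin m → ℝ
  realizes : transfer (Matrix.fromBlocks As 0 0 Au) (Sum.elim Bs Bu) (Sum.elim Cs Cu) = K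
  stable : ∀ z ∈ eigenvalues As, ‖z‖ < 1
  unstable : ∀ z ∈ eigenvalues Au, 1 ≤ ‖z‖
  controllable : Submodule.span ℝ (Set.range fun k : ℕ => (Au ^ k) *ᵥ Bu) = ⊤
  observable : ∀ x : Fin m → ℝ, (∀ k : ℕ, Cu ⬝ᵥ ((Au ^ k) *ᵥ x) = 0) → x = 0

namespace Realization

variable {K : RatFunc ℝ} {p m : ℕ}

/-- `∑ log₂ |λ_i (A_u)|`, in bits per channel use. -/
def rate (r : Realization K p m) : ℝ :=
  ((eigenvalues r.Au).map fun z => Real.logb 2 ‖z‖).sum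

/-! ### The encoder/decoder pair -/

/-- One step of the decoder, which runs `K` on the channel output `y`; the state is
`(x_s, x̂_u)`. -/
def decoderStep (r : Realization K p m) (d : (Fin p → ℝ) × (Fin m → ℝ)) (y : ℝ) :
    (Fin p → ℝ) × (Fin m → ℝ) :=
  (r.As *ᵥ d.1 + y • r.Bs, r.Au *ᵥ d.2 + y • r.Bu)

/-- The signal `û` that the decoder feeds back. -/
def feedback (r : Realization K p m) (d : (Fin p → ℝ) × (Fin m → ℝ)) : ℝ :=
  r.Cs ⬝ᵥ d.1 + r.Cu ⬝ᵥ d.2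

/-- The encoder signal `ũ_u (k) = C_u x̃_u (k)`, where `x̃_u (k) = A_u ^ k x₀`. -/
def encoderSignal (r : Realization K p m) (x₀ : Fin m → ℝ) (k : ℕ) : ℝ :=
  r.Cu ⬝ᵥ ((r.Au ^ k) *ᵥ x₀)

/-- The channel input at time `k` when the decoder state is `d`: the loop is closed with negative
feedback, `u = - (ũ_u + û)`. -/
def inputOf (r : Realization K p m) (x₀ : Fin m → ℝ) (k : ℕ)
    (d : (Fin p → ℝ) × (Fin m → ℝ)) : ℝ :=
  -(r.encoderSignal x₀ k + r.feedback d)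

/-- The decoder state in the closed loop over the channel `y (k) = u (k) + w (k)`, for the encoder
initial state `x₀` and the noise path `w`. -/
def decoderState (r : Realization K p m) (x₀ : Fin m → ℝ) (w : ℕ → ℝ) :
    ℕ → (Fin p → ℝ) × (Fin m → ℝ)
  | 0 => (0, 0)
  | k + 1 => r.decoderStep (r.decoderState x₀ w k)
      (r.inputOf x₀ k (r.decoderState x₀ w k) + w k)

/-- The channel input `u (k)`. -/
def input (r : Realization K p m) (x₀ : Fin m → ℝ) (w : ℕ → ℝ) (k : ℕ) : ℝ :=
  r.inputOf x₀ k (r.decoderState x₀ w k)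

/-- The decoder's estimate `- x̂_{u 0} (k) = - A_u ^ (-k) x̂_u (k)` of the encoder initial state,
available after the `k` channel uses `0, …, k - 1`. -/
def estimate (r : Realization K p m) (x₀ : Fin m → ℝ) (w : ℕ → ℝ) (k : ℕ) : Fin m → ℝ :=
  -(((r.Au⁻¹) ^ k) *ᵥ (r.decoderState x₀ w k).2)

end Realization

/-! ### Message constellation

In the coordinates given by the columns of `P`, the `i`-th side of the unit cube is cut into `N i`
equal pieces; the messages are the cells. -/

/-- The initial state carrying the message `j`: the centre of the cell `j`. -/
def messagePoint {m : ℕ} (P : Matrix (Fin m) (Fin m) ℝ) (N : Fin m → ℕ)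
    (j : (i : Fin m) → Fin (N i)) : Fin m → ℝ :=
  P *ᵥ fun i => (((j i : ℕ) : ℝ) + 1 / 2) / (N i : ℝ)

/-- The (index of the) decoded cell: the one containing the estimate, after moving each coordinate
that lies outside the unit cube to the nearest cell. -/
def decode {m : ℕ} (P : Matrix (Fin m) (Fin m) ℝ) (N : Fin m → ℕ) (x : Fin m → ℝ) :
    Fin m → ℕ :=
  fun i => min (N i - 1) ⌊(N i : ℝ) * (P⁻¹ *ᵥ x) i⌋₊

/-- The probability of error after `n` channel uses, for uniformly distributed messages. -/
def errorProb {Ω : Type*} [MeasurableSpace Ω] {K : RatFunc ℝ} {p m : ℕ} (r : Realization K p m)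
    (W : ℕ → Ω → ℝ) (μ : Measure Ω) (P : Matrix (Fin m) (Fin m) ℝ) (N : Fin m → ℕ) (n : ℕ) : ℝ :=
  (∑ j : (i : Fin m) → Fin (N i),
      μ.real {ω | decode P N (r.estimate (messagePoint P N j) (fun k => W k ω) n) ≠
        fun i => (j i : ℕ)}) / ((∏ i, N i : ℕ) : ℝ)

/-- The average transmission power over `n` channel uses when the message `j` is sent. -/
def averagePower {Ω : Type*} [MeasurableSpace Ω] {K : RatFunc ℝ} {p m : ℕ} (r : Realization K p m)
    (W : ℕ → Ω → ℝ) (μ : Measure Ω) (P : Matrix (Fin m) (Fin m) ℝ) (N : Fin m → ℕ)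
    (j : (i : Fin m) → Fin (N i)) (n : ℕ) : ℝ :=
  (1 / (n : ℝ)) * ∑ k ∈ Finset.range n,
    ∫ ω, (r.input (messagePoint P N j) (fun l => W l ω) k) ^ 2 ∂μ

end FeedbackCode

end

/-! Write `F = A - B C` for the closed-loop matrix. The encoder state moves freely under `A_u`, so
adding it to the decoder's unstable state gives a vector (`loopState`) that obeys `ξ(k+1) = F ξ(k) +
w(k) B`, with `u = -C ξ`. The message enters only through the initial value of `ξ`.

Everything rests on stability of `F` (`closedLoop_stable`). By coprimeness
(`exists_num_add_denom_eq`), `1 + Q = (num + denom) / denom` has exactly the eigenvalues of `A_u` as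
zeros outside the open disc. Hence the unstable modes cancel from the characteristic polynomial of
`F`.

Reliability: the estimation error is `A_u⁻ⁿ ξ_u(n)` (`estimate_eq`). In suitable real coordinates,
row `i` of `A_u⁻ⁿ` shrinks almost like `|λ_i|⁻ⁿ` (`exists_coordinates_inv_pow_le`), while `ξ` is
bounded by the largest noise sample. With slightly fewer than `|λ_i|ⁿ` cells in direction `i`, an
error forces some noise sample beyond `τⁿ` with `τ > 1`. The Gaussian tail makes this doubly
exponentially unlikely (`exists_errorProb_le`).

Power: `u` is a decaying response to the message plus the noise passed through a truncation of `Q`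
(`tendsto_sum_impulse`). Its second moment converges, and so do the Cesàro means.

The integral identity is Jensen's formula, in the form of the Mahler measure, for `num + denom` and
`denom` (`bode_integral`). Existence of a realization comes from partial fractions and companion
matrices (`exists_realization`). -/

namespace FeedbackCode

/-! ### Growth of powers of a linear map -/

/-- The powers of `T` on a generalized eigenvector grow at most at the rate of the eigenvalue. -/
lemma exists_norm_pow_apply_le {V : Type*} [NormedAddCommGroup V] [NormedSpace ℂ V]
    (T : Module.End ℂ V) {ν : ℂ} {ρ : ℝ} (hρ : ‖ν‖ < ρ) (k : ℕ) :
    ∀ v : V, ((T - algebraMap ℂ (Module.End ℂ V) ν) ^ k) v = 0 →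
      ∃ C : ℝ, ∀ n : ℕ, ‖(T ^ n) v‖ ≤ C * ρ ^ n := by
  have hρ0 : 0 < ρ := (norm_nonneg ν).trans_lt hρ
  induction k with
  | zero =>
    intro v hv
    have : v = 0 := by simpa using hv
    exact ⟨0, fun n => by simp [this]⟩
  | succ k ih =>
    intro v hv
    rw [pow_succ, Module.End.mul_apply] at hv
    obtain ⟨C, hC⟩ := ih _ hv
    have hC0 : 0 ≤ C := by simpa using (norm_nonneg _).trans (hC 0)
    -- `D` dominates the value at `n = 0` and satisfies `‖ν‖ D + C ≤ ρ D`, which is what the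
    -- recursion needs to close.
    set D : ℝ := max ‖v‖ (C / (ρ - ‖ν‖))
    have hD1 : C ≤ D * (ρ - ‖ν‖) := by
      exact (div_le_iff₀ (by linarith)).1 (le_max_right ‖v‖ _)
    refine ⟨D, fun n => ?_⟩
    induction n with
    | zero =>
      rw [pow_zero, pow_zero, mul_one]
      exact le_max_left ‖v‖ (C / (ρ - ‖ν‖))
    | succ n ihn =>
      have h1 : (T ^ (n + 1)) v = ν • (T ^ n) v +
          (T ^ n) ((T - algebraMap ℂ (Module.End ℂ V) ν) v) := by
        rw [pow_succ, Module.End.mul_apply, LinearMap.sub_apply, map_sub,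
          Module.algebraMap_end_apply, map_smul]
        abel
      calc ‖(T ^ (n + 1)) v‖ ≤ ‖ν‖ * (D * ρ ^ n) + C * ρ ^ n := by
            rw [h1]
            refine (norm_add_le _ _).trans (add_le_add ?_ (hC n))
            rw [norm_smul]
            exact mul_le_mul_of_nonneg_left ihn (norm_nonneg _)
        _ ≤ ‖ν‖ * (D * ρ ^ n) + D * (ρ - ‖ν‖) * ρ ^ n := by gcongr
        _ = D * ρ ^ (n + 1) := by ring

/-- The vectors along which the powers of `T` grow at most at the rate `ρ`. -/
def growthSubmodule {V : Type*} [NormedAddCommGroup V] [NormedSpace ℂ V]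
    (T : Module.End ℂ V) (ρ : ℝ) : Submodule ℂ V where
  carrier := {v | ∃ C : ℝ, ∀ n : ℕ, ‖(T ^ n) v‖ ≤ C * ρ ^ n}
  zero_mem' := ⟨0, fun n => by simp⟩
  add_mem' := by
    rintro v w ⟨C, hC⟩ ⟨D, hD⟩
    refine ⟨C + D, fun n => ?_⟩
    rw [map_add, add_mul]
    exact (norm_add_le _ _).trans (add_le_add (hC n) (hD n))
  smul_mem' := by
    rintro c v ⟨C, hC⟩
    refine ⟨‖c‖ * C, fun n => ?_⟩
    rw [map_smul, norm_smul, mul_assoc]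
    exact mul_le_mul_of_nonneg_left (hC n) (norm_nonneg _)

lemma maxGenEigenspace_le_growthSubmodule {V : Type*} [NormedAddCommGroup V] [NormedSpace ℂ V]
    (T : Module.End ℂ V) {ν : ℂ} {ρ : ℝ} (hρ : ‖ν‖ < ρ) :
    T.maxGenEigenspace ν ≤ growthSubmodule T ρ := by
  intro v hv
  obtain ⟨k, hk⟩ := (Module.End.mem_maxGenEigenspace T ν v).1 hv
  exact exists_norm_pow_apply_le T hρ k v (by simpa [Algebra.algebraMap_eq_smul_one] using hk)

lemma maxGenEigenspace_eq_bot {V : Type*} [AddCommGroup V] [Module ℂ V] [FiniteDimensional ℂ V]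
    (T : Module.End ℂ V) {ν : ℂ} (hν : ¬ T.HasEigenvalue ν) : T.maxGenEigenspace ν = ⊥ := by
  rw [← Submodule.finrank_eq_zero (R := ℂ), LinearMap.finrank_maxGenEigenspace_eq]
  refine Polynomial.rootMultiplicity_eq_zero fun h => hν ?_
  exact (Module.End.hasEigenvalue_iff_isRoot_charpoly T ν).2 h

lemma mem_eigenvalues_iff {m : ℕ} (A : Matrix (Fin m) (Fin m) ℝ) (z : ℂ) :
    z ∈ eigenvalues A ↔ A.charpoly.eval₂ (algebraMap ℝ ℂ) z = 0 := by
  rw [eigenvalues, Polynomial.mem_roots (Matrix.charpoly_monic _).ne_zero, Matrix.charpoly_map,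
    Polynomial.IsRoot.def, Polynomial.eval_map]

lemma isUnit_det_of_eigenvalues_ne_zero {m : ℕ} (A : Matrix (Fin m) (Fin m) ℝ)
    (hA : ∀ z ∈ eigenvalues A, z ≠ 0) : IsUnit A.det := by
  rw [isUnit_iff_ne_zero]
  intro h0
  refine hA 0 ((mem_eigenvalues_iff A 0).2 ?_) rfl
  have h1 : A.charpoly.coeff 0 = 0 := by
    have h2 := A.det_eq_sign_charpoly_coeff
    rw [h0] at h2
    simpa using h2.symm
  rw [Polynomial.eval₂_at_zero, h1, map_zero]

/-- The powers of a matrix with all eigenvalues in the open unit disc decay exponentially. -/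
lemma exists_abs_pow_apply_le {ι : Type*} [Fintype ι] [DecidableEq ι] (A : Matrix ι ι ℝ)
    (hA : ∀ z : ℂ, A.charpoly.eval₂ (algebraMap ℝ ℂ) z = 0 → ‖z‖ < 1) :
    ∃ ρ : ℝ, 0 < ρ ∧ ρ < 1 ∧ ∃ C : ℝ, 0 ≤ C ∧ ∀ n i j, |(A ^ n) i j| ≤ C * ρ ^ n := by
  set T : Module.End ℂ (ι → ℂ) := Matrix.toLin' (A.map (algebraMap ℝ ℂ)) with hT
  have hev : ∀ z, T.HasEigenvalue z → ‖z‖ < 1 := by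
    intro z hz
    apply hA
    have := (Module.End.hasEigenvalue_iff_isRoot_charpoly T z).1 hz
    rwa [hT, Matrix.charpoly_toLin', Matrix.charpoly_map, Polynomial.IsRoot.def,
      Polynomial.eval_map] at this
  obtain ⟨ρ, hρ0, hρ1, hρ⟩ : ∃ ρ : ℝ, 0 < ρ ∧ ρ < 1 ∧ ∀ z, T.HasEigenvalue z → ‖z‖ < ρ := by
    have hfin : {z : ℂ | T.HasEigenvalue z}.Finite := Module.End.finite_hasEigenvalue T
    -- The `1 / 2` keeps `ρ` positive when there is no nonzero eigenvalue.
    obtain ⟨ρ, h1, h2⟩ := exists_between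
      (show max (1 / 2) ((hfin.toFinset.sup fun z => ‖z‖₊ : NNReal) : ℝ) < 1 by
        refine max_lt (by norm_num) ?_
        rw [← NNReal.coe_one, NNReal.coe_lt_coe, Finset.sup_lt_iff (by simp)]
        intro z hz
        exact hev z (by simpa using hz))
    refine ⟨ρ, lt_of_le_of_lt (by norm_num) ((le_max_left _ _).trans_lt h1), h2, fun z hz => ?_⟩
    refine lt_of_le_of_lt ?_ ((le_max_right _ _).trans_lt h1)
    rw [← coe_nnnorm, NNReal.coe_le_coe]
    exact Finset.le_sup (f := fun z : ℂ => ‖z‖₊) (by simpa using hz)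
  have htop : growthSubmodule T ρ = ⊤ := by
    rw [eq_top_iff, ← Module.End.iSup_maxGenEigenspace_eq_top T]
    refine iSup_le fun ν => ?_
    by_cases hν : T.HasEigenvalue ν
    · exact maxGenEigenspace_le_growthSubmodule T (hρ ν hν)
    · rw [maxGenEigenspace_eq_bot T hν]
      exact bot_le
  have hmem : ∀ j, ∃ C : ℝ, ∀ n : ℕ, ‖(T ^ n) (Pi.single j 1)‖ ≤ C * ρ ^ n := fun j =>
    (show (Pi.single j 1 : ι → ℂ) ∈ growthSubmodule T ρ by rw [htop]; trivial)
  choose C hC using hmem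
  have hC0 : ∀ j, 0 ≤ C j := fun j => by simpa using (norm_nonneg _).trans (hC j 0)
  refine ⟨ρ, hρ0, hρ1, ∑ j, C j, Finset.sum_nonneg fun j _ => hC0 j, fun n i j => ?_⟩
  have h1 : (T ^ n) (Pi.single j 1) i = ((A ^ n) i j : ℂ) := by
    rw [hT, ← Matrix.toLin'_pow, Matrix.toLin'_apply, ← Matrix.map_pow,
      Matrix.mulVec_single_one]
    rfl
  calc |(A ^ n) i j| = ‖(T ^ n) (Pi.single j 1) i‖ := by
        rw [h1, Complex.norm_real, Real.norm_eq_abs]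
    _ ≤ C j * ρ ^ n := (norm_le_pi_norm _ i).trans (hC j n)
    _ ≤ (∑ j, C j) * ρ ^ n := by
        gcongr
        exact Finset.single_le_sum (fun j _ => hC0 j) (Finset.mem_univ j)

/-! ### A real basis adapted to the moduli of the eigenvalues -/

/-- Since `S - μ⁻¹ = (-μ⁻¹ S)(T - μ)` with commuting factors, a power of `T - μ` that kills a vector
gives a power of `S - μ⁻¹` that kills it. -/
lemma maxGenEigenspace_le_maxGenEigenspace_inv {V : Type*} [AddCommGroup V] [Module ℂ V]
    {T S : Module.End ℂ V} (hST : S * T = 1) (hTS : T * S = 1) {μ : ℂ} (hμ : μ ≠ 0) :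
    T.maxGenEigenspace μ ≤ S.maxGenEigenspace μ⁻¹ := by
  intro v hv
  obtain ⟨k, hk⟩ := (Module.End.mem_maxGenEigenspace T μ v).1 hv
  refine (Module.End.mem_maxGenEigenspace S μ⁻¹ v).2 ⟨k, ?_⟩
  have h1 : S - μ⁻¹ • (1 : Module.End ℂ V) = (-μ⁻¹ • S) * (T - μ • 1) := by
    rw [mul_sub, smul_mul_assoc, hST, smul_mul_smul_comm, mul_one, neg_mul, inv_mul_cancel₀ hμ]
    simp only [neg_smul, one_smul]
    abel
  have hc : Commute (-μ⁻¹ • S) (T - μ • 1) := by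
    have h2 : Commute S T := hST.trans hTS.symm
    exact (h2.sub_right ((Commute.one_right S).smul_right μ)).smul_left _
  rw [h1, hc.mul_pow, Module.End.mul_apply, hk, map_zero]

/-- A complex basis of generalized eigenvectors. -/
lemma exists_basis_maxGenEigenspace {m : ℕ} (A : Matrix (Fin m) (Fin m) ℂ) :
    ∃ (ψ : Module.Basis (Fin m) ℂ (Fin m → ℂ)) (z : Fin m → ℂ),
      (∀ i, z i ∈ A.charpoly.roots) ∧
      (∀ f : ℂ → ℝ, ∑ i, f (z i) = (A.charpoly.roots.map f).sum) ∧
      ∀ i, ψ i ∈ Module.End.maxGenEigenspace (Matrix.toLin' A) (z i) := by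
  classical
  set T : Module.End ℂ (Fin m → ℂ) := Matrix.toLin' A with hT
  have hchar : LinearMap.charpoly T = A.charpoly := Matrix.charpoly_toLin' A
  set s := A.charpoly.roots.toFinset with hs
  have hint : DirectSum.IsInternal fun μ : s => T.maxGenEigenspace (μ : ℂ) := by
    refine DirectSum.isInternal_submodule_of_iSupIndep_of_iSup_eq_top
      ((Module.End.independent_maxGenEigenspace T).comp Subtype.val_injective) ?_
    rw [eq_top_iff, ← Module.End.iSup_maxGenEigenspace_eq_top T]
    refine iSup_le fun ν => ?_
    by_cases hν : T.HasEigenvalue ν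
    · have : ν ∈ s := by
        rw [hs, Multiset.mem_toFinset, Polynomial.mem_roots (Matrix.charpoly_monic _).ne_zero,
          ← hchar]
        exact (Module.End.hasEigenvalue_iff_isRoot_charpoly T ν).1 hν
      exact le_iSup (fun μ : s => T.maxGenEigenspace (μ : ℂ)) ⟨ν, this⟩
    · rw [maxGenEigenspace_eq_bot T hν]
      exact bot_le
  let b := hint.collectedBasis fun μ : s => Module.finBasis ℂ (T.maxGenEigenspace (μ : ℂ))
  let e := b.indexEquiv (Pi.basisFun ℂ (Fin m))
  refine ⟨b.reindex e, fun i => ((e.symm i).1 : ℂ), fun i => ?_, fun f => ?_, fun i => ?_⟩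
  · exact Multiset.mem_toFinset.1 (e.symm i).1.2
  -- A generalized eigenspace has the algebraic multiplicity as its dimension, so the labels `z`
  -- list each root as often as the characteristic polynomial does.
  · rw [Finset.sum_multiset_map_count, ← hs, ← Finset.sum_coe_sort s,
      Equiv.sum_comp e.symm (fun x => f (x.1 : ℂ)), Fintype.sum_sigma]
    refine Finset.sum_congr rfl fun μ _ => ?_
    simp only [Finset.sum_const, Finset.card_univ, Fintype.card_fin]
    rw [LinearMap.finrank_maxGenEigenspace_eq, hchar, Polynomial.count_roots]
  · rw [Module.Basis.reindex_apply]
    exact hint.collectedBasis_mem _ _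

/-- Among the real and imaginary parts of a complex basis there is a real basis. -/
lemma exists_re_im_det_ne_zero {m : ℕ} (ψ : Matrix (Fin m) (Fin m) ℂ) (hψ : ψ.det ≠ 0) :
    ∃ Φ : Matrix (Fin m) (Fin m) ℝ, Φ.det ≠ 0 ∧
      ∀ i, (∀ j, Φ i j = (ψ i j).re) ∨ (∀ j, Φ i j = (ψ i j).im) := by
  classical
  let a : Fin m → Fin m → ℂ := fun i j => ((ψ i j).re : ℂ)
  let b : Fin m → Fin m → ℂ := fun i j => Complex.I * ((ψ i j).im : ℂ)
  have hab : ψ = a + b := by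
    ext i j
    simp [a, b, mul_comm Complex.I]
  -- Expanding `det (Re + i Im)` by multilinearity in the rows, some choice of one part per row has
  -- nonzero determinant. The factors `i` then come out of the rows.
  have h1 := (Matrix.detRowAlternating (n := Fin m) (R := ℂ)).toMultilinearMap.map_add_univ a b
  have h2 : ∃ s : Finset (Fin m), Matrix.det (s.piecewise a b) ≠ 0 := by
    by_contra! h
    refine hψ ?_
    rw [hab]
    refine h1.trans (Finset.sum_eq_zero fun s _ => h s)
  obtain ⟨s, hs⟩ := h2
  refine ⟨Matrix.of fun i j => if i ∈ s then (ψ i j).re else (ψ i j).im, fun h0 => hs ?_,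
    fun i => ?_⟩
  · have h3 : (s.piecewise a b : Matrix (Fin m) (Fin m) ℂ) =
        Matrix.of fun i j => (if i ∈ s then 1 else Complex.I) *
          ((Matrix.of fun i j => if i ∈ s then (ψ i j).re else (ψ i j).im).map
            (algebraMap ℝ ℂ)) i j := by
      ext i j
      by_cases hi : i ∈ s <;> simp [hi, a, b]
    rw [h3, Matrix.det_mul_column, ← RingHom.mapMatrix_apply, ← RingHom.map_det, h0]
    simp
  · by_cases hi : i ∈ s <;> simp [hi]

/-- Coordinates in which the powers of the inverse matrix decay, row by row, at the rates of the
inverse eigenvalues. -/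
lemma exists_coordinates_inv_pow_le {m : ℕ} (A : Matrix (Fin m) (Fin m) ℝ)
    (hA : ∀ z ∈ eigenvalues A, z ≠ 0) :
    ∃ (P : Matrix (Fin m) (Fin m) ℝ) (r : Fin m → ℝ), IsUnit P.det ∧
      (∀ i, ∃ z ∈ eigenvalues A, r i = ‖z‖) ∧
      (∀ f : ℝ → ℝ, ∑ i, f (r i) = ((eigenvalues A).map fun z => f ‖z‖).sum) ∧
      ∀ i ρ, (r i)⁻¹ < ρ → ∃ C : ℝ, 0 ≤ C ∧ ∀ n j, |(P⁻¹ * A⁻¹ ^ n) i j| ≤ C * ρ ^ n := by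
  have hdet := isUnit_det_of_eigenvalues_ne_zero A hA
  -- The transpose appears because the rows of `P⁻¹` come from left generalized eigenvectors: the
  -- rows of `ψ A⁻ⁿ` are the vectors `Sⁿ ψ_i`.
  obtain ⟨ψ, z, hz, hsum, hψ⟩ := exists_basis_maxGenEigenspace (Aᵀ.map (algebraMap ℝ ℂ))
  have hroots : (Aᵀ.map (algebraMap ℝ ℂ)).charpoly.roots = eigenvalues A := by
    rw [eigenvalues, Matrix.transpose_map, Matrix.charpoly_transpose]
  rw [hroots] at hz hsum
  set T : Module.End ℂ (Fin m → ℂ) := Matrix.toLin' (Aᵀ.map (algebraMap ℝ ℂ)) with hT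
  set S : Module.End ℂ (Fin m → ℂ) := Matrix.toLin' ((A⁻¹)ᵀ.map (algebraMap ℝ ℂ)) with hS
  have hST : S * T = 1 := by
    rw [hS, hT, Module.End.mul_eq_comp, ← Matrix.toLin'_mul, ← Matrix.map_mul,
      ← Matrix.transpose_mul, Matrix.mul_nonsing_inv _ hdet, Matrix.transpose_one,
      Matrix.map_one _ (map_zero _) (map_one _), Matrix.toLin'_one]
    rfl
  have hTS : T * S = 1 := mul_eq_one_comm.1 hST
  obtain ⟨Φ, hΦ, hre⟩ := exists_re_im_det_ne_zero (Matrix.of fun i => ψ i) (by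
    have h1 : LinearIndependent ℂ (Matrix.of fun i => ψ i).row := ψ.linearIndependent
    exact ((Matrix.isUnit_iff_isUnit_det _).1
      (Matrix.linearIndependent_rows_iff_isUnit.1 h1)).ne_zero)
  -- As `A⁻ⁿ` is real, the real or imaginary part of a row of `ψ` inherits the decay of that row.
  refine ⟨Φ⁻¹, fun i => ‖z i‖, ?_, fun i => ⟨z i, hz i, rfl⟩, fun f => hsum fun w => f ‖w‖,
    fun i ρ hρ => ?_⟩
  · rw [Matrix.det_nonsing_inv]
    exact (isUnit_iff_ne_zero.2 hΦ).ringInverse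
  · obtain ⟨C, hC⟩ := maxGenEigenspace_le_growthSubmodule S (ν := (z i)⁻¹) (ρ := ρ)
      (by rwa [norm_inv]) (maxGenEigenspace_le_maxGenEigenspace_inv hST hTS (hA _ (hz i)) (hψ i))
    refine ⟨C, by simpa using (norm_nonneg _).trans (hC 0), fun n j => ?_⟩
    rw [Matrix.nonsing_inv_nonsing_inv _ (isUnit_iff_ne_zero.2 hΦ)]
    have h1 : (S ^ n) (ψ i) j = ∑ l, ψ i l * ((A⁻¹ ^ n) l j : ℂ) := by
      rw [hS, ← Matrix.toLin'_pow, Matrix.toLin'_apply, ← Matrix.map_pow, ← Matrix.transpose_pow,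
        Matrix.mulVec, dotProduct]
      exact Finset.sum_congr rfl fun l _ => mul_comm _ _
    refine le_trans ?_ ((norm_le_pi_norm _ j).trans (hC n))
    rw [h1, Matrix.mul_apply]
    rcases hre i with h | h
    · refine le_trans (le_of_eq ?_) (Complex.abs_re_le_norm _)
      simp [h]
    · refine le_trans (le_of_eq ?_) (Complex.abs_im_le_norm _)
      simp [h]

/-! ### Transfer functions as quotients of polynomials -/

section Transfer

open Polynomial

variable {ι : Type*} [Fintype ι] [DecidableEq ι]

/-- The numerator `C adj(z - A) B` of the transfer function over the characteristic polynomial. -/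
noncomputable def transferNum (A : Matrix ι ι ℝ) (B C : ι → ℝ) : ℝ[X] :=
  (fun i => Polynomial.C (C i)) ⬝ᵥ
    ((charmatrix A).adjugate *ᵥ fun i => Polynomial.C (B i))

lemma scalar_sub_map_eq (A : Matrix ι ι ℝ) :
    Matrix.scalar ι (RatFunc.X : RatFunc ℝ) - A.map (algebraMap ℝ (RatFunc ℝ)) =
      (charmatrix A).map (algebraMap ℝ[X] (RatFunc ℝ)) := by
  ext i j
  by_cases h : i = j
  · subst h
    simp
  · simp [h]

lemma det_scalar_sub_map (A : Matrix ι ι ℝ) :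
    (Matrix.scalar ι (RatFunc.X : RatFunc ℝ) - A.map (algebraMap ℝ (RatFunc ℝ))).det =
      algebraMap ℝ[X] (RatFunc ℝ) A.charpoly := by
  rw [scalar_sub_map_eq, ← RingHom.mapMatrix_apply, ← RingHom.map_det]
  rfl

lemma algebraMap_charpoly_ne_zero (A : Matrix ι ι ℝ) :
    algebraMap ℝ[X] (RatFunc ℝ) A.charpoly ≠ 0 :=
  RatFunc.algebraMap_ne_zero A.charpoly_monic.ne_zero

lemma isUnit_det_scalar_sub_map (A : Matrix ι ι ℝ) :
    IsUnit (Matrix.scalar ι (RatFunc.X : RatFunc ℝ) - A.map (algebraMap ℝ (RatFunc ℝ))).det := by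
  rw [det_scalar_sub_map, isUnit_iff_ne_zero]
  exact algebraMap_charpoly_ne_zero A

/-- Spares computing a resolvent: block-diagonal and companion systems are handled by exhibiting a
solution of `(z - A) x = B`. -/
lemma transfer_eq_of_mulVec_eq (A : Matrix ι ι ℝ) (B C : ι → ℝ) (x : ι → RatFunc ℝ)
    (hx : (Matrix.scalar ι (RatFunc.X : RatFunc ℝ) - A.map (algebraMap ℝ (RatFunc ℝ))) *ᵥ x =
      fun i => algebraMap ℝ (RatFunc ℝ) (B i)) :
    transfer A B C = (fun i => algebraMap ℝ (RatFunc ℝ) (C i)) ⬝ᵥ x := by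
  rw [transfer, ← hx, Matrix.mulVec_mulVec, Matrix.nonsing_inv_mul _ (isUnit_det_scalar_sub_map A),
    Matrix.one_mulVec]

lemma algebraMap_transferNum (A : Matrix ι ι ℝ) (B C : ι → ℝ) :
    algebraMap ℝ[X] (RatFunc ℝ) (transferNum A B C) =
      algebraMap ℝ[X] (RatFunc ℝ) A.charpoly * transfer A B C := by
  have h1 : (Matrix.scalar ι (RatFunc.X : RatFunc ℝ) - A.map (algebraMap ℝ (RatFunc ℝ))).adjugate =
      (charmatrix A).adjugate.map (algebraMap ℝ[X] (RatFunc ℝ)) := by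
    rw [scalar_sub_map_eq, ← RingHom.mapMatrix_apply, ← RingHom.map_adjugate]
    rfl
  have h0 := algebraMap_charpoly_ne_zero A
  rw [transfer, Matrix.inv_def, det_scalar_sub_map, h1, Ring.inverse_eq_inv', Matrix.smul_mulVec,
    dotProduct_smul, smul_eq_mul, mul_inv_cancel_left₀ h0, transferNum]
  simp only [dotProduct, Matrix.mulVec, map_sum, map_mul, Matrix.map_apply,
    IsScalarTower.algebraMap_apply ℝ ℝ[X] (RatFunc ℝ), Polynomial.algebraMap_eq]

/-- The matrix determinant lemma for characteristic polynomials. -/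
lemma charpoly_sub_vecMulVec (A : Matrix ι ι ℝ) (B C : ι → ℝ) :
    (A - vecMulVec B C).charpoly = A.charpoly + transferNum A B C := by
  apply RatFunc.algebraMap_injective ℝ
  rw [map_add, algebraMap_transferNum, ← det_scalar_sub_map, ← det_scalar_sub_map A]
  have h1 : Matrix.scalar ι (RatFunc.X : RatFunc ℝ) -
      (A - vecMulVec B C).map (algebraMap ℝ (RatFunc ℝ)) =
      (Matrix.scalar ι (RatFunc.X : RatFunc ℝ) - A.map (algebraMap ℝ (RatFunc ℝ))) +
        replicateCol Unit (fun i => algebraMap ℝ (RatFunc ℝ) (B i)) *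
          replicateRow Unit (fun i => algebraMap ℝ (RatFunc ℝ) (C i)) := by
    ext i j
    simp [Matrix.mul_apply, vecMulVec_apply]
    ring
  rw [h1, det_add_replicateCol_mul_replicateRow (isUnit_det_scalar_sub_map A),
    det_unique (n := Unit)]
  simp [transfer, Matrix.mul_assoc, Matrix.mul_apply, dotProduct, Matrix.mulVec, mul_add]

/-- State feedback does not change the numerator of the transfer function. -/
lemma transferNum_sub_vecMulVec (A : Matrix ι ι ℝ) (B C : ι → ℝ) :
    transferNum (A - vecMulVec B C) B C = transferNum A B C := by
  have h1 := charpoly_sub_vecMulVec A B C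
  -- Feedback with `-B` undoes feedback with `B`; comparing the two determinant identities equates
  -- the numerators.
  have h2 := charpoly_sub_vecMulVec (A - vecMulVec B C) (-B) C
  have h3 : A - vecMulVec B C - vecMulVec (-B) C = A := by
    rw [neg_vecMulVec]; abel
  have h4 : transferNum (A - vecMulVec B C) (-B) C = -transferNum (A - vecMulVec B C) B C := by
    have : (fun i => Polynomial.C ((-B) i)) = -fun i => Polynomial.C (B i) := by
      ext1 i; simp
    rw [transferNum, this, Matrix.mulVec_neg, dotProduct_neg]; rfl
  rw [h3, h4, h1] at h2
  linear_combination h2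

lemma transfer_fromBlocks {κ : Type*} [Fintype κ] [DecidableEq κ] (A : Matrix ι ι ℝ)
    (A' : Matrix κ κ ℝ) (B C : ι → ℝ) (B' C' : κ → ℝ) :
    transfer (fromBlocks A 0 0 A') (Sum.elim B B') (Sum.elim C C') =
      transfer A B C + transfer A' B' C' := by
  set φ := algebraMap ℝ (RatFunc ℝ)
  set M := Matrix.scalar ι (RatFunc.X : RatFunc ℝ) - A.map φ with hM
  set M' := Matrix.scalar κ (RatFunc.X : RatFunc ℝ) - A'.map φ with hM'
  have h1 : Matrix.scalar (ι ⊕ κ) (RatFunc.X : RatFunc ℝ) - (fromBlocks A 0 0 A').map φ =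
      fromBlocks M 0 0 M' := by
    ext (i | i) (j | j) <;> simp [hM, hM', Matrix.diagonal_apply]
  rw [transfer_eq_of_mulVec_eq _ _ _
    (Sum.elim (M⁻¹ *ᵥ fun i => φ (B i)) (M'⁻¹ *ᵥ fun i => φ (B' i)))]
  · rw [transfer, transfer]
    simp [dotProduct, Fintype.sum_sum_type, hM, hM', φ]
  · rw [h1, fromBlocks_mulVec]
    simp only [Sum.elim_comp_inl, Sum.elim_comp_inr, Matrix.mulVec_mulVec]
    rw [Matrix.mul_nonsing_inv _ (isUnit_det_scalar_sub_map A),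
      Matrix.mul_nonsing_inv _ (isUnit_det_scalar_sub_map A'), Matrix.one_mulVec,
      Matrix.one_mulVec, Matrix.zero_mul, Matrix.zero_mul, Matrix.zero_mulVec, Matrix.zero_mulVec,
      zero_add, add_zero]
    ext (i | i) <;> rfl

lemma transferNum_fromBlocks {κ : Type*} [Fintype κ] [DecidableEq κ] (A : Matrix ι ι ℝ)
    (A' : Matrix κ κ ℝ) (B C : ι → ℝ) (B' C' : κ → ℝ) :
    transferNum (fromBlocks A 0 0 A') (Sum.elim B B') (Sum.elim C C') =
      transferNum A B C * A'.charpoly + transferNum A' B' C' * A.charpoly := by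
  apply RatFunc.algebraMap_injective ℝ
  simp only [map_add, map_mul, algebraMap_transferNum, transfer_fromBlocks,
    charpoly_fromBlocks_zero₁₂]
  ring

/-! ### Controllability and observability -/

lemma mulVec_map_re {m : ℕ} (A : Matrix (Fin m) (Fin m) ℝ) (x : Fin m → ℂ) (i : Fin m) :
    ((A.map Complex.ofReal *ᵥ x) i).re = (A *ᵥ fun j => (x j).re) i := by
  simp [Matrix.mulVec, dotProduct]

lemma mulVec_map_im {m : ℕ} (A : Matrix (Fin m) (Fin m) ℝ) (x : Fin m → ℂ) (i : Fin m) :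
    ((A.map Complex.ofReal *ᵥ x) i).im = (A *ᵥ fun j => (x j).im) i := by
  simp [Matrix.mulVec, dotProduct]

lemma pow_mulVec_eq_smul {R : Type*} [CommRing R] {m : ℕ} {A : Matrix (Fin m) (Fin m) R}
    {x : Fin m → R} {z : R} (h : A *ᵥ x = z • x) (k : ℕ) : A ^ k *ᵥ x = z ^ k • x := by
  induction k with
  | zero => simp
  | succ k ih => rw [pow_succ, ← Matrix.mulVec_mulVec, h, Matrix.mulVec_smul, ih, smul_smul, pow_succ']

lemma eval₂_charpoly {m : ℕ} (A : Matrix (Fin m) (Fin m) ℝ) (z : ℂ) :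
    A.charpoly.eval₂ (algebraMap ℝ ℂ) z =
      (Matrix.scalar (Fin m) z - A.map (algebraMap ℝ ℂ)).det := by
  rw [← Polynomial.eval_map, ← Matrix.charpoly_map, Matrix.eval_charpoly]

/-- Feedback moves every mode that is controllable and observable. -/
lemma eval₂_charpoly_sub_vecMulVec_ne_zero {m : ℕ} (A : Matrix (Fin m) (Fin m) ℝ)
    (B C : Fin m → ℝ)
    (hB : Submodule.span ℝ (Set.range fun k : ℕ => (A ^ k) *ᵥ B) = ⊤)
    (hC : ∀ x : Fin m → ℝ, (∀ k : ℕ, C ⬝ᵥ ((A ^ k) *ᵥ x) = 0) → x = 0) {z : ℂ}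
    (hz : A.charpoly.eval₂ (algebraMap ℝ ℂ) z = 0) :
    (A - vecMulVec B C).charpoly.eval₂ (algebraMap ℝ ℂ) z ≠ 0 := by
  intro hz'
  set φ := algebraMap ℝ ℂ
  rw [eval₂_charpoly] at hz hz'
  obtain ⟨x, hx0, hx⟩ := Matrix.exists_mulVec_eq_zero_iff.2 hz'
  obtain ⟨w, hw0, hw⟩ := Matrix.exists_vecMul_eq_zero_iff.2 hz
  have hscal : ∀ y : Fin m → ℂ, Matrix.scalar (Fin m) z *ᵥ y = z • y := by
    intro y; ext i; simp [Matrix.mulVec_diagonal]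
  -- the left eigenvector is not orthogonal to `B`
  have hwA : (A.map φ)ᵀ *ᵥ w = z • w := by
    rw [Matrix.mulVec_transpose]
    rw [Matrix.vecMul_sub, sub_eq_zero] at hw
    rw [← hw, ← hscal, ← Matrix.vecMul_transpose]
    simp
  have hwB : w ⬝ᵥ (fun i => φ (B i)) ≠ 0 := by
    intro h0
    have key : ∀ k : ℕ, w ⬝ᵥ (fun i => φ ((A ^ k *ᵥ B) i)) = 0 := by
      intro k
      have h1 : (fun i => φ ((A ^ k *ᵥ B) i)) = A.map φ ^ k *ᵥ fun i => φ (B i) := by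
        rw [← Matrix.map_pow]
        ext i
        simp [Matrix.mulVec, dotProduct]
      rw [h1, Matrix.dotProduct_mulVec, ← Matrix.mulVec_transpose, Matrix.transpose_pow,
        pow_mulVec_eq_smul hwA, smul_dotProduct, h0, smul_zero]
    have hspan : ∀ v : Fin m → ℝ, w ⬝ᵥ (fun i => φ (v i)) = 0 := by
      intro v
      have hv : v ∈ Submodule.span ℝ (Set.range fun k : ℕ => (A ^ k) *ᵥ B) := hB ▸ trivial
      induction hv using Submodule.span_induction with
      | mem x hx => obtain ⟨k, rfl⟩ := hx; exact key k
      | zero => simp [dotProduct]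
      | add x y _ _ hx hy =>
        simpa [dotProduct, mul_add, Finset.sum_add_distrib] using congrArg₂ (· + ·) hx hy
      | smul a x _ hx =>
        have : w ⬝ᵥ (fun i => φ ((a • x) i)) = φ a * (w ⬝ᵥ fun i => φ (x i)) := by
          simp only [dotProduct, Finset.mul_sum, Pi.smul_apply, smul_eq_mul, map_mul]
          exact Finset.sum_congr rfl fun i _ => by ring
        rw [this, hx, mul_zero]
    refine hw0 (funext fun i => ?_)
    have := hspan (Pi.single i 1)
    simpa [dotProduct, Pi.single_apply, apply_ite φ] using this
  -- so the right eigenvector is not observable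
  have hAx : (Matrix.scalar (Fin m) z - A.map φ) *ᵥ x =
      -(((fun i => φ (C i)) ⬝ᵥ x) • fun i => φ (B i)) := by
    have h1 : (A - vecMulVec B C).map φ = A.map φ - vecMulVec (fun i => φ (B i)) fun i => φ (C i) := by
      ext i j; simp [vecMulVec_apply]
    rw [h1, ← sub_add, Matrix.add_mulVec] at hx
    rw [eq_neg_iff_add_eq_zero, ← hx]
    congr 1
    ext i
    simp [Matrix.mulVec, dotProduct, vecMulVec_apply, Finset.sum_mul]
    exact Finset.sum_congr rfl fun i _ => by ring
  have hCx : (fun i => φ (C i)) ⬝ᵥ x = 0 := by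
    have h1 := congrArg (fun y => w ⬝ᵥ y) hAx
    simp only [dotProduct_neg, dotProduct_smul, smul_eq_mul] at h1
    rw [Matrix.dotProduct_mulVec, hw, zero_dotProduct] at h1
    exact (mul_eq_zero.1 (neg_eq_zero.1 h1.symm)).resolve_right hwB
  have hAx' : A.map φ *ᵥ x = z • x := by
    rw [hCx, zero_smul, neg_zero, Matrix.sub_mulVec, hscal, sub_eq_zero] at hAx
    exact hAx.symm
  have hobs : ∀ k : ℕ, (fun i => φ (C i)) ⬝ᵥ (A ^ k).map φ *ᵥ x = 0 := by
    intro k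
    rw [Matrix.map_pow, pow_mulVec_eq_smul hAx', dotProduct_smul, hCx, smul_zero]
  have hre : (fun i => (x i).re) = 0 := hC _ fun k => by
    have := congrArg Complex.re (hobs k)
    simpa [dotProduct, mulVec_map_re, φ] using this
  have him : (fun i => (x i).im) = 0 := hC _ fun k => by
    have := congrArg Complex.im (hobs k)
    simpa [dotProduct, mulVec_map_im, φ] using this
  exact hx0 (funext fun i => Complex.ext (congrFun hre i) (congrFun him i))

lemma isCoprime_of_forall_eval₂_ne_zero {f g : ℝ[X]}
    (h : ∀ z : ℂ, f.eval₂ (algebraMap ℝ ℂ) z = 0 → g.eval₂ (algebraMap ℝ ℂ) z ≠ 0) :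
    IsCoprime f g :=
  (Polynomial.isCoprime_iff_aeval_ne_zero_of_isAlgClosed (k := ℝ) ℂ f g).2 fun z =>
    (em (aeval z f = 0)).elim (fun h0 => Or.inr (h z h0)) Or.inl

/-- By the determinant lemma, a common zero would be an eigenvalue of both `A` and `A - B C`, that
is, a mode that feedback fails to move. -/
lemma isCoprime_charpoly_transferNum {m : ℕ} (A : Matrix (Fin m) (Fin m) ℝ) (B C : Fin m → ℝ)
    (hB : Submodule.span ℝ (Set.range fun k : ℕ => (A ^ k) *ᵥ B) = ⊤)
    (hC : ∀ x : Fin m → ℝ, (∀ k : ℕ, C ⬝ᵥ ((A ^ k) *ᵥ x) = 0) → x = 0) :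
    IsCoprime A.charpoly (transferNum A B C) := by
  refine isCoprime_of_forall_eval₂_ne_zero fun z hz hz' => ?_
  refine eval₂_charpoly_sub_vecMulVec_ne_zero A B C hB hC hz ?_
  rw [charpoly_sub_vecMulVec, eval₂_add, hz, hz', add_zero]

/-! ### The controller with Youla parameter `Q` -/

lemma num_add_denom_monic {Q : RatFunc ℝ} (hQ : IsStrictlyProper Q) :
    (Q.num + Q.denom).Monic :=
  Q.monic_denom.add_of_right hQ

lemma controller_eq {Q : RatFunc ℝ} (hQ : IsStrictlyProper Q) :
    controller Q = algebraMap ℝ[X] (RatFunc ℝ) (-Q.num) /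
      algebraMap ℝ[X] (RatFunc ℝ) (Q.num + Q.denom) := by
  have hd : algebraMap ℝ[X] (RatFunc ℝ) Q.denom ≠ 0 :=
    RatFunc.algebraMap_ne_zero Q.denom_ne_zero
  have hf : algebraMap ℝ[X] (RatFunc ℝ) (Q.num + Q.denom) ≠ 0 :=
    RatFunc.algebraMap_ne_zero (num_add_denom_monic hQ).ne_zero
  rw [map_add] at hf
  have h1 : controller Q = -(algebraMap ℝ[X] (RatFunc ℝ) Q.num / algebraMap ℝ[X] (RatFunc ℝ) Q.denom)
      * (1 + algebraMap ℝ[X] (RatFunc ℝ) Q.num / algebraMap ℝ[X] (RatFunc ℝ) Q.denom)⁻¹ := by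
    rw [RatFunc.num_div_denom, controller]
  have h2 : (1 + algebraMap ℝ[X] (RatFunc ℝ) Q.num / algebraMap ℝ[X] (RatFunc ℝ) Q.denom) =
      (algebraMap ℝ[X] (RatFunc ℝ) Q.num + algebraMap ℝ[X] (RatFunc ℝ) Q.denom) /
        algebraMap ℝ[X] (RatFunc ℝ) Q.denom := by
    field_simp
    ring
  rw [h1, h2, map_neg, map_add, inv_div]
  field_simp

lemma isCoprime_num_add_denom_num (Q : RatFunc ℝ) : IsCoprime (Q.num + Q.denom) Q.num := by
  have := Q.isCoprime_num_denom.symm.add_mul_left_left 1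
  rwa [mul_one, add_comm] at this

namespace Realization

variable {K Q : RatFunc ℝ} {p m : ℕ}

/-- The state matrix of the controller. -/
def stateMatrix (r : Realization K p m) : Matrix (Fin p ⊕ Fin m) (Fin p ⊕ Fin m) ℝ :=
  fromBlocks r.As 0 0 r.Au

/-- The input vector of the controller. -/
def inputVec (r : Realization K p m) : Fin p ⊕ Fin m → ℝ := Sum.elim r.Bs r.Bu

/-- The output vector of the controller. -/
def outputVec (r : Realization K p m) : Fin p ⊕ Fin m → ℝ := Sum.elim r.Cs r.Cu

/-- The state matrix of the controller in closed loop with the channel. -/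
def closedLoop (r : Realization K p m) : Matrix (Fin p ⊕ Fin m) (Fin p ⊕ Fin m) ℝ :=
  r.stateMatrix - vecMulVec r.inputVec r.outputVec

/-- The realization identity `K = -num / (num + denom)` with denominators cleared; common factors
stay, since the stable block may have hidden modes. -/
lemma transferNum_mul (hQ : IsStrictlyProper Q) (r : Realization (controller Q) p m) :
    transferNum r.stateMatrix r.inputVec r.outputVec * (Q.num + Q.denom) =
      -Q.num * (r.As.charpoly * r.Au.charpoly) := by
  have hf : algebraMap ℝ[X] (RatFunc ℝ) (Q.num + Q.denom) ≠ 0 :=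
    RatFunc.algebraMap_ne_zero (num_add_denom_monic hQ).ne_zero
  apply RatFunc.algebraMap_injective ℝ
  rw [map_mul, algebraMap_transferNum]
  have h1 : transfer r.stateMatrix r.inputVec r.outputVec =
      algebraMap ℝ[X] (RatFunc ℝ) (-Q.num) / algebraMap ℝ[X] (RatFunc ℝ) (Q.num + Q.denom) :=
    Eq.trans r.realizes (controller_eq hQ)
  rw [h1, mul_assoc, div_mul_cancel₀ _ hf, ← map_mul, stateMatrix,
    charpoly_fromBlocks_zero₁₂, mul_comm]

/-- The unstable modes of the controller are the zeros of `1 + Q` outside the open unit disc. -/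
lemma exists_num_add_denom_eq (hQ : IsStrictlyProper Q) (r : Realization (controller Q) p m) :
    ∃ f g : ℝ[X], Q.num + Q.denom = r.Au.charpoly * f ∧ r.As.charpoly = f * g := by
  have h := transferNum_mul hQ r
  have hsu : IsCoprime r.Au.charpoly r.As.charpoly := by
    refine isCoprime_of_forall_eval₂_ne_zero fun z hz hz' => ?_
    exact absurd (r.stable z ((mem_eigenvalues_iff _ _).2 hz'))
      (not_lt.2 (r.unstable z ((mem_eigenvalues_iff _ _).2 hz)))
  -- Modulo the characteristic polynomial of `A_u`, the full numerator is the numerator of the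
  -- unstable block times the characteristic polynomial of `A_s`. Both are coprime to it.
  have hnum : IsCoprime r.Au.charpoly (transferNum r.stateMatrix r.inputVec r.outputVec) := by
    rw [stateMatrix, inputVec, outputVec, transferNum_fromBlocks, add_comm]
    exact ((isCoprime_charpoly_transferNum r.Au r.Bu r.Cu r.controllable
      r.observable).mul_right hsu).add_mul_right_right _
  obtain ⟨f, hf⟩ : r.Au.charpoly ∣ Q.num + Q.denom := by
    refine hnum.dvd_of_dvd_mul_left ?_
    rw [h]
    exact Dvd.intro_left (-Q.num * r.As.charpoly) (by ring)
  -- Conversely, `num + denom` is coprime to `num`, so every zero of `1 + Q` must be a mode of the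
  -- realization.
  obtain ⟨g, hg⟩ : Q.num + Q.denom ∣ r.As.charpoly * r.Au.charpoly := by
    refine (isCoprime_num_add_denom_num Q).neg_right.dvd_of_dvd_mul_left ?_
    rw [← h]
    exact Dvd.intro_left _ rfl
  refine ⟨f, g, hf, mul_right_cancel₀ r.Au.charpoly_monic.ne_zero ?_⟩
  rw [hg, hf]; ring

/-- The determinant lemma adds the numerator to the open-loop characteristic polynomial `χ`. By
`transferNum_mul` the sum, times `num + denom`, is `χ (num + denom - num)`. -/
lemma charpoly_closedLoop_mul (hQ : IsStrictlyProper Q) (r : Realization (controller Q) p m) :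
    r.closedLoop.charpoly * (Q.num + Q.denom) = r.As.charpoly * r.Au.charpoly * Q.denom := by
  rw [closedLoop, charpoly_sub_vecMulVec, add_mul, transferNum_mul hQ r, stateMatrix,
    charpoly_fromBlocks_zero₁₂]
  ring

/-- The closed loop is internally stable. -/
lemma closedLoop_stable (hQs : IsStable Q) (hQ : IsStrictlyProper Q)
    (r : Realization (controller Q) p m) (z : ℂ)
    (hz : r.closedLoop.charpoly.eval₂ (algebraMap ℝ ℂ) z = 0) : ‖z‖ < 1 := by
  obtain ⟨f, g, hf, hg⟩ := exists_num_add_denom_eq hQ r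
  have h := charpoly_closedLoop_mul hQ r
  -- The factor for `A_u` cancels here; what remains is a divisor of the stable block and the stable
  -- denominator of `Q`.
  have h1 : r.closedLoop.charpoly = g * Q.denom := by
    refine mul_right_cancel₀ (num_add_denom_monic hQ).ne_zero (h.trans ?_)
    rw [hf, hg]; ring
  rw [h1, eval₂_mul, mul_eq_zero] at hz
  rcases hz with hz | hz
  · refine r.stable z ((mem_eigenvalues_iff _ _).2 ?_)
    rw [hg, eval₂_mul, hz, mul_zero]
  · exact hQs z hz

/-- The closed loop from the noise to the channel input has transfer function `Q`. -/
lemma transferNum_closedLoop_mul (hQ : IsStrictlyProper Q) (r : Realization (controller Q) p m) :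
    -transferNum r.closedLoop r.inputVec r.outputVec * Q.denom =
      Q.num * r.closedLoop.charpoly := by
  refine mul_right_cancel₀ (num_add_denom_monic hQ).ne_zero ?_
  have h1 := transferNum_mul hQ r
  have h2 := charpoly_closedLoop_mul hQ r
  rw [closedLoop] at h2 ⊢
  rw [transferNum_sub_vecMulVec]
  linear_combination (-Q.denom) * h1 - Q.num * h2

end Realization

end Transfer

/-! ### Companion realizations -/

section Companion

open Polynomial

/-- The companion matrix of `X ^ n + ⋯`, whose last row holds the negated coefficients. -/
def companionMatrix (n : ℕ) (f : ℝ[X]) : Matrix (Fin n) (Fin n) ℝ :=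
  fun i j => if (i : ℕ) + 1 = n then -f.coeff j else if (j : ℕ) = i + 1 then 1 else 0

/-- The input vector of the companion realization. -/
def companionInput (n : ℕ) : Fin n → ℝ := fun i => if (i : ℕ) + 1 = n then 1 else 0

/-- The vector with entries `zⁱ / f` solves the state equation: the upper rows are shifts, and the
last row reads `f / f = 1`. -/
lemma transfer_companion {n : ℕ} {f g : ℝ[X]} (hf : f.Monic) (hn : f.natDegree = n)
    (hg : g.degree < f.degree) :
    transfer (companionMatrix n f) (companionInput n) (fun i => g.coeff i) =
      algebraMap ℝ[X] (RatFunc ℝ) g / algebraMap ℝ[X] (RatFunc ℝ) f := by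
  have hf0 : algebraMap ℝ[X] (RatFunc ℝ) f ≠ 0 := RatFunc.algebraMap_ne_zero hf.ne_zero
  have hsum : ∀ h : ℝ[X], algebraMap ℝ[X] (RatFunc ℝ) (∑ i : Fin n, C (h.coeff i) * X ^ (i : ℕ)) =
      ∑ i : Fin n, algebraMap ℝ (RatFunc ℝ) (h.coeff i) * (RatFunc.X : RatFunc ℝ) ^ (i : ℕ) := by
    intro h
    simp
  have hfX : algebraMap ℝ[X] (RatFunc ℝ) f = (RatFunc.X : RatFunc ℝ) ^ n +
      ∑ i : Fin n, algebraMap ℝ (RatFunc ℝ) (f.coeff i) * (RatFunc.X : RatFunc ℝ) ^ (i : ℕ) := by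
    conv_lhs => rw [hf.as_sum, hn, Finset.sum_range fun i => C (f.coeff i) * X ^ i]
    rw [map_add, ← hsum, map_pow, RatFunc.algebraMap_X]
  rw [transfer_eq_of_mulVec_eq _ _ _
    (fun i : Fin n => (RatFunc.X : RatFunc ℝ) ^ (i : ℕ) / algebraMap ℝ[X] (RatFunc ℝ) f)]
  · have hgs : g = ∑ i : Fin n, C (g.coeff i) * X ^ (i : ℕ) := by
      rcases eq_or_ne g 0 with h0 | h0
      · simp [h0]
      · conv_lhs => rw [g.as_sum_range' n (hn ▸ natDegree_lt_natDegree h0 hg), Finset.sum_range]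
        simp [C_mul_X_pow_eq_monomial]
    conv_rhs => rw [hgs, hsum]
    simp [dotProduct, Finset.sum_div, mul_div_assoc]
  · ext i
    rw [Matrix.sub_mulVec, Pi.sub_apply]
    have h1 : (Matrix.scalar (Fin n) (RatFunc.X : RatFunc ℝ) *ᵥ fun i : Fin n =>
        (RatFunc.X : RatFunc ℝ) ^ (i : ℕ) / algebraMap ℝ[X] (RatFunc ℝ) f) i =
        (RatFunc.X : RatFunc ℝ) ^ ((i : ℕ) + 1) / algebraMap ℝ[X] (RatFunc ℝ) f := by
      simp [Matrix.mulVec_diagonal, pow_succ', mul_div_assoc]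
    rw [h1]
    by_cases hi : (i : ℕ) + 1 = n
    · have h2 : ((companionMatrix n f).map (algebraMap ℝ (RatFunc ℝ)) *ᵥ fun i : Fin n =>
          (RatFunc.X : RatFunc ℝ) ^ (i : ℕ) / algebraMap ℝ[X] (RatFunc ℝ) f) i =
          -(∑ i : Fin n, algebraMap ℝ (RatFunc ℝ) (f.coeff i) * (RatFunc.X : RatFunc ℝ) ^ (i : ℕ)) /
            algebraMap ℝ[X] (RatFunc ℝ) f := by
        simp [Matrix.mulVec, dotProduct, companionMatrix, hi, Finset.sum_div, mul_div_assoc, neg_div]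
      rw [h2, ← sub_div, sub_neg_eq_add, hi, ← hfX, div_self hf0]
      simp [companionInput, hi]
    · have hi' : (i : ℕ) + 1 < n := by omega
      have h2 : ((companionMatrix n f).map (algebraMap ℝ (RatFunc ℝ)) *ᵥ fun i : Fin n =>
          (RatFunc.X : RatFunc ℝ) ^ (i : ℕ) / algebraMap ℝ[X] (RatFunc ℝ) f) i =
          (RatFunc.X : RatFunc ℝ) ^ ((i : ℕ) + 1) / algebraMap ℝ[X] (RatFunc ℝ) f := by
        rw [Matrix.mulVec, dotProduct, Finset.sum_eq_single ⟨(i : ℕ) + 1, hi'⟩]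
        · simp [companionMatrix, hi]
        · intro j _ hj
          have : (j : ℕ) ≠ i + 1 := fun h => hj (Fin.ext h)
          simp [companionMatrix, hi, this]
        · simp
      rw [h2, sub_self]
      simp [companionInput, hi]

/-- Realizing `1 / f` shows that `f` divides the characteristic polynomial, and both are monic of
degree `n`. For `n = 0` the fraction `1 / f` is not strictly proper. -/
lemma charpoly_companionMatrix {n : ℕ} {f : ℝ[X]} (hf : f.Monic) (hn : f.natDegree = n) :
    (companionMatrix n f).charpoly = f := by
  refine (eq_of_monic_of_dvd_of_natDegree_le hf (charpoly_monic (companionMatrix n f)) ?_ ?_)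
  · rcases Nat.eq_zero_or_pos n with h0 | h0
    · rw [hf.natDegree_eq_zero.1 (hn.trans h0)]
      exact one_dvd _
    · refine ⟨transferNum (companionMatrix n f) (companionInput n)
        fun i : Fin n => (1 : ℝ[X]).coeff i, ?_⟩
      apply RatFunc.algebraMap_injective ℝ
      have hf0 : algebraMap ℝ[X] (RatFunc ℝ) f ≠ 0 := RatFunc.algebraMap_ne_zero hf.ne_zero
      rw [map_mul, algebraMap_transferNum, transfer_companion hf hn, map_one]
      · field_simp
      · rw [degree_one, degree_eq_natDegree hf.ne_zero, hn]
        exact_mod_cast h0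
  · rw [charpoly_natDegree_eq_dim, hn, Fintype.card_fin]

lemma companionMatrix_mulVec_of_lt {n : ℕ} (f : ℝ[X]) (x : Fin n → ℝ) (i : Fin n)
    (hi : (i : ℕ) + 1 < n) : (companionMatrix n f *ᵥ x) i = x ⟨i + 1, hi⟩ := by
  rw [Matrix.mulVec, dotProduct, Finset.sum_eq_single ⟨(i : ℕ) + 1, hi⟩]
  · simp [companionMatrix, hi.ne]
  · intro j _ hj
    have : (j : ℕ) ≠ i + 1 := fun h => hj (Fin.ext h)
    simp [companionMatrix, hi.ne, this]
  · simp

/-- The span is invariant and contains the last basis vector `B`. Since `e_i = A e_(i+1) + f_(i+1)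
B`, the other basis vectors follow in descending order. -/
lemma companion_controllable (n : ℕ) (f : ℝ[X]) :
    Submodule.span ℝ (Set.range fun k : ℕ => (companionMatrix n f ^ k) *ᵥ companionInput n) = ⊤ := by
  set A := companionMatrix n f with hA
  set S := Submodule.span ℝ (Set.range fun k : ℕ => (A ^ k) *ᵥ companionInput n) with hS
  have hinv : ∀ v ∈ S, A *ᵥ v ∈ S := by
    intro v hv
    induction hv using Submodule.span_induction with
    | mem x hx =>
      obtain ⟨k, rfl⟩ := hx
      refine Submodule.subset_span ⟨k + 1, ?_⟩
      simp only [Matrix.mulVec_mulVec, pow_succ']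
    | zero => simp
    | add x y _ _ hx hy => rw [Matrix.mulVec_add]; exact S.add_mem hx hy
    | smul a x _ hx => rw [Matrix.mulVec_smul]; exact S.smul_mem a hx
  have hB : companionInput n ∈ S := Submodule.subset_span ⟨0, by simp⟩
  have hsingle : ∀ k : ℕ, ∀ i : Fin n, (i : ℕ) + 1 + k = n → Pi.single i (1 : ℝ) ∈ S := by
    intro k
    induction k with
    | zero =>
      intro i hi
      convert hB using 1
      ext j
      by_cases hj : j = i
      · subst hj; simpa [companionInput] using hi
      · have : (j : ℕ) + 1 ≠ n := fun h => hj (Fin.ext (by omega))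
        simp [companionInput, hj, this]
    | succ k ih =>
      intro i hi
      have hi' : (i : ℕ) + 1 < n := by omega
      have h1 := hinv _ (ih ⟨i + 1, hi'⟩ (by simp only; omega))
      have h2 : Pi.single i (1 : ℝ) = A *ᵥ Pi.single ⟨i + 1, hi'⟩ 1 +
          f.coeff (i + 1) • companionInput n := by
        ext j
        rw [Matrix.mulVec_single_one]
        by_cases hj : (j : ℕ) + 1 = n
        · have hji : j ≠ i := fun h => by subst h; omega
          simp [hA, companionMatrix, companionInput, hj, hji]
        · by_cases hji : j = i
          · subst hji; simp [hA, companionMatrix, companionInput, hj]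
          · have : (i : ℕ) ≠ j := fun h => hji (Fin.ext h.symm)
            simp [hA, companionMatrix, companionInput, hj, hji, this]
      rw [h2]
      exact S.add_mem h1 (S.smul_mem _ hB)
  rw [eq_top_iff]
  intro v _
  rw [← Finset.univ_sum_single v]
  refine S.sum_mem fun i _ => ?_
  have h1 := S.smul_mem (v i) (hsingle (n - 1 - i) i (by omega))
  rwa [← Pi.single_smul, smul_eq_mul, mul_one] at h1

lemma companionMatrix_pow_mulVec_zero {n : ℕ} (f : ℝ[X]) (x : Fin n → ℝ) (k : ℕ) :
    ∀ (i : Fin n) (h : (i : ℕ) + k < n), (companionMatrix n f ^ k *ᵥ x) i = x ⟨i + k, h⟩ := by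
  induction k with
  | zero => intro i h; simp
  | succ k ih =>
    intro i h
    rw [pow_succ', ← Matrix.mulVec_mulVec, companionMatrix_mulVec_of_lt _ _ _ (by omega),
      ih _ (by simp only; omega)]
    congr 2
    simp only
    omega

/-- The output row is the first row of `g(A)`, so entry `i` of `g(A) x` is the output at time `i`,
which vanishes. With `f(A) = 0`, a Bézout relation gives `x = 0`. -/
lemma companion_observable {n : ℕ} {f g : ℝ[X]} (hf : f.Monic) (hn : f.natDegree = n)
    (hg : g.degree < f.degree) (hfg : IsCoprime f g) (x : Fin n → ℝ)
    (hx : ∀ k : ℕ, (fun i : Fin n => g.coeff i) ⬝ᵥ (companionMatrix n f ^ k *ᵥ x) = 0) :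
    x = 0 := by
  set A := companionMatrix n f with hA
  have hgA : aeval A g *ᵥ x = 0 := by
    ext i
    have h0 : 0 < n := i.pos
    have h1 : (aeval A g *ᵥ x) i = (A ^ (i : ℕ) *ᵥ (aeval A g *ᵥ x)) ⟨0, h0⟩ := by
      rw [companionMatrix_pow_mulVec_zero f _ _ ⟨0, h0⟩ (by simp)]
      congr 1
      ext; simp
    have h2 : A ^ (i : ℕ) *ᵥ (aeval A g *ᵥ x) = aeval A g *ᵥ (A ^ (i : ℕ) *ᵥ x) := by
      rw [Matrix.mulVec_mulVec, Matrix.mulVec_mulVec]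
      congr 1
      rw [← aeval_X_pow (R := ℝ) A, ← map_mul, ← map_mul, mul_comm]
    have h3 : ∀ y : Fin n → ℝ, (aeval A g *ᵥ y) ⟨0, h0⟩ = (fun i : Fin n => g.coeff i) ⬝ᵥ y := by
      intro y
      rw [aeval_eq_sum_range' (n := n) (by
        rcases eq_or_ne g 0 with hg0 | hg0
        · simpa [hg0] using h0
        · exact hn ▸ natDegree_lt_natDegree hg0 hg), Matrix.sum_mulVec, Finset.sum_apply,
        Finset.sum_range, dotProduct]
      refine Finset.sum_congr rfl fun j _ => ?_
      rw [Matrix.smul_mulVec, Pi.smul_apply, smul_eq_mul,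
        companionMatrix_pow_mulVec_zero f _ _ ⟨0, h0⟩ (by simp)]
      congr 2
      ext; simp
    rw [h1, h2, h3, hx]
    rfl
  obtain ⟨a, b, hab⟩ := hfg
  have h4 : aeval A (a * f + b * g) *ᵥ x = 0 := by
    have h5 : aeval A f = 0 := by
      have := Matrix.aeval_self_charpoly A
      rwa [hA, charpoly_companionMatrix hf hn] at this
    rw [map_add, map_mul, map_mul, h5, mul_zero, zero_add, ← Matrix.mulVec_mulVec, hgA,
      Matrix.mulVec_zero]
  rwa [hab, map_one, Matrix.one_mulVec] at h4

/-! ### Splitting the modes -/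

/-- The roots are Galois conjugate over `ℝ`, and the only automorphisms are the identity and
conjugation. Hence an irreducible real factor lies entirely inside or entirely outside the open
disc. -/
lemma norm_eq_of_eval₂_minpoly_eq_zero {z w : ℂ}
    (h : (minpoly ℝ z).eval₂ (algebraMap ℝ ℂ) w = 0) : ‖w‖ = ‖z‖ := by
  have hz : IsIntegral ℝ z := Algebra.IsIntegral.isIntegral z
  have h1 : IsConjRoot ℝ z w := isConjRoot_of_aeval_eq_zero hz h
  have : IsAlgClosure ℝ ℂ := ⟨inferInstance, inferInstance⟩
  have : Normal ℝ ℂ := inferInstance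
  obtain ⟨σ, hσ⟩ := isConjRoot_iff_exists_algEquiv.1 h1
  rw [← hσ]
  rcases Complex.real_algHom_eq_id_or_conj σ.toAlgHom with h2 | h2
  · have := DFunLike.congr_fun h2 w
    simp at this
    rw [this]
  · have := DFunLike.congr_fun h2 w
    simp at this
    rw [this, Complex.norm_conj]

lemma exists_stable_mul_unstable (n : ℕ) : ∀ f : ℝ[X], f.natDegree = n → f.Monic →
    ∃ fs fu : ℝ[X], fs.Monic ∧ fu.Monic ∧ f = fs * fu ∧
      (∀ z : ℂ, fs.eval₂ (algebraMap ℝ ℂ) z = 0 → ‖z‖ < 1) ∧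
      (∀ z : ℂ, fu.eval₂ (algebraMap ℝ ℂ) z = 0 → 1 ≤ ‖z‖) := by
  induction n using Nat.strong_induction_on with
  | _ n ih =>
    intro f hn hf
    rcases Nat.eq_zero_or_pos n with h0 | h0
    · have : f = 1 := hf.natDegree_eq_zero.1 (hn.trans h0)
      exact ⟨1, 1, monic_one, monic_one, by simp [this], by simp, by simp⟩
    · obtain ⟨z, hz⟩ := IsAlgClosed.exists_aeval_eq_zero ℂ f (by
        rw [degree_eq_natDegree hf.ne_zero, hn]; exact_mod_cast h0.ne')
      have hzi : IsIntegral ℝ z := Algebra.IsIntegral.isIntegral z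
      obtain ⟨h, hh⟩ := minpoly.dvd ℝ z hz
      have hp := minpoly.monic hzi
      have hhm : h.Monic := hp.of_mul_monic_left (hh ▸ hf)
      have hdeg : h.natDegree < n := by
        have h1 := hp.natDegree_mul hhm
        rw [← hh, hn] at h1
        have := minpoly.natDegree_pos hzi
        omega
      obtain ⟨fs, fu, hfs, hfu, hmul, hs, hu⟩ := ih _ hdeg h rfl hhm
      by_cases hz1 : ‖z‖ < 1
      · refine ⟨minpoly ℝ z * fs, fu, hp.mul hfs, hfu, by rw [hh, hmul, mul_assoc],
          fun w hw => ?_, hu⟩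
        rw [eval₂_mul, mul_eq_zero] at hw
        rcases hw with hw | hw
        · rwa [norm_eq_of_eval₂_minpoly_eq_zero hw]
        · exact hs w hw
      · refine ⟨fs, minpoly ℝ z * fu, hfs, hp.mul hfu, by rw [hh, hmul]; ring, hs,
          fun w hw => ?_⟩
        rw [eval₂_mul, mul_eq_zero] at hw
        rcases hw with hw | hw
        · rw [norm_eq_of_eval₂_minpoly_eq_zero hw]; exact not_lt.1 hz1
        · exact hu w hw

/-- Take a Bézout relation and reduce `gu` modulo `fu`. The bound on `gs` is then forced, as `gs *
fu = q - gu * fs` has degree below that of `fs * fu`. -/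
lemma exists_partialFractions {fs fu q : ℝ[X]} (hfs : fs.Monic) (hfu : fu.Monic)
    (hco : IsCoprime fs fu) (hq : q.degree < (fs * fu).degree) :
    ∃ gs gu : ℝ[X], q = gs * fu + gu * fs ∧ gs.degree < fs.degree ∧ gu.degree < fu.degree := by
  obtain ⟨a, b, hab⟩ := hco
  have h1 : (q * a) %ₘ fu + fu * ((q * a) /ₘ fu) = q * a := modByMonic_add_div (q * a) fu
  have h2 : q = (q * b + ((q * a) /ₘ fu) * fs) * fu + ((q * a) %ₘ fu) * fs := by
    linear_combination (-q) * hab - fs * h1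
  refine ⟨_, _, h2, ?_, degree_modByMonic_lt _ hfu⟩
  set gs := q * b + ((q * a) /ₘ fu) * fs
  set gu := (q * a) %ₘ fu
  by_contra! hle
  have h3 : gs * fu = q - gu * fs := by linear_combination -h2
  have h4 : (gs * fu).degree < (fs * fu).degree := by
    rw [h3]
    refine (degree_sub_le _ _).trans_lt (max_lt hq ?_)
    rw [degree_mul, degree_mul, add_comm]
    have h5 : gu.degree < fu.degree := degree_modByMonic_lt _ hfu
    rw [degree_eq_natDegree hfs.ne_zero]
    rw [degree_eq_natDegree hfu.ne_zero] at h5 ⊢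
    rcases eq_or_ne gu 0 with h6 | h6
    · rw [h6, degree_zero, WithBot.add_bot]
      exact WithBot.bot_lt_coe _
    · rw [degree_eq_natDegree h6] at h5 ⊢
      norm_cast at h5 ⊢
      omega
  rw [degree_mul, degree_mul] at h4
  exact absurd (add_le_add_left hle fu.degree) (not_le.2 h4)

/-- Every strictly causal stable `Q` gives a controller with a realization. -/
lemma exists_realization {Q : RatFunc ℝ} (hQ : IsStrictlyProper Q) :
    ∃ p m : ℕ, Nonempty (Realization (controller Q) p m) := by
  obtain ⟨fs, fu, hfs, hfu, hf, hs, hu⟩ :=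
    exists_stable_mul_unstable _ (Q.num + Q.denom) rfl (num_add_denom_monic hQ)
  have hco : IsCoprime fs fu := isCoprime_of_forall_eval₂_ne_zero fun z hz hz' =>
    absurd (hs z hz) (not_lt.2 (hu z hz'))
  obtain ⟨gs, gu, hg, hgs, hgu⟩ := exists_partialFractions (q := -Q.num) hfs hfu hco (by
    rw [← hf, degree_neg, degree_add_eq_right_of_degree_lt hQ]; exact hQ)
  -- Needed for observability: `fu` divides `num + denom`, hence is coprime to `-num = gs fu + gu
  -- fs`, hence to `gu`.
  have hcogu : IsCoprime fu gu := by
    have h1 : IsCoprime fu (-Q.num) := by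
      refine ((isCoprime_num_add_denom_num Q).neg_right).of_isCoprime_of_dvd_left ?_
      exact hf ▸ Dvd.intro_left fs rfl
    rw [hg] at h1
    have h2 : IsCoprime fu (gu * fs) := by
      have h3 : gu * fs = gs * fu + gu * fs + fu * -gs := by ring
      rw [h3]
      exact h1.add_mul_left_right (-gs)
    exact h2.of_mul_right_left
  have hf0 : ∀ f : ℝ[X], f.Monic → algebraMap ℝ[X] (RatFunc ℝ) f ≠ 0 := fun f h =>
    RatFunc.algebraMap_ne_zero h.ne_zero
  refine ⟨fs.natDegree, fu.natDegree, ⟨{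
    As := companionMatrix _ fs
    Au := companionMatrix _ fu
    Bs := companionInput _
    Bu := companionInput _
    Cs := fun i => gs.coeff i
    Cu := fun i => gu.coeff i
    realizes := ?_
    stable := ?_
    unstable := ?_
    controllable := companion_controllable _ fu
    observable := companion_observable hfu rfl hgu hcogu }⟩⟩
  · rw [transfer_fromBlocks, transfer_companion hfs rfl hgs, transfer_companion hfu rfl hgu,
      controller_eq hQ, hf, hg, div_add_div _ _ (hf0 _ hfs) (hf0 _ hfu)]
    simp only [map_add, map_mul]
    rw [mul_comm (algebraMap ℝ[X] (RatFunc ℝ) fs) (algebraMap ℝ[X] (RatFunc ℝ) gu)]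
  · intro z hz
    rw [mem_eigenvalues_iff, charpoly_companionMatrix hfs rfl] at hz
    exact hs z hz
  · intro z hz
    rw [mem_eigenvalues_iff, charpoly_companionMatrix hfu rfl] at hz
    exact hu z hz

end Companion

/-! ### The Bode integral -/

section Bode

open Polynomial

lemma denom_eval₂_ne_zero {F : RatFunc ℝ} (hF : IsStable F) (θ : ℝ) :
    F.denom.eval₂ (algebraMap ℝ ℂ) (Complex.exp (θ * Complex.I)) ≠ 0 := fun h => by
  simpa [Complex.norm_exp_ofReal_mul_I] using hF _ h

lemma logMahlerMeasure_eq_integral (p : ℂ[X]) :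
    IntervalIntegrable (fun θ : ℝ => Real.log ‖p.eval (Complex.exp (θ * Complex.I))‖) volume
        (-Real.pi) Real.pi ∧
      (1 / (2 * Real.pi)) * ∫ θ in (-Real.pi)..Real.pi,
        Real.log ‖p.eval (Complex.exp (θ * Complex.I))‖ = p.logMahlerMeasure := by
  set g : ℝ → ℝ := fun θ => Real.log ‖p.eval (Complex.exp (θ * Complex.I))‖ with hg
  have hcm : (fun x => Real.log ‖p.eval (circleMap 0 1 x)‖) = g := by
    ext x; simp [circleMap, hg]
  have hper : Function.Periodic g (2 * Real.pi) := by
    intro θ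
    have : Complex.exp (((θ + 2 * Real.pi : ℝ) : ℂ) * Complex.I) = Complex.exp (θ * Complex.I) := by
      push_cast
      rw [add_mul, Complex.exp_periodic]
    simp only [hg, this]
  have hint : IntervalIntegrable g volume 0 (2 * Real.pi) := hcm ▸ p.intervalIntegrable_mahlerMeasure
  refine ⟨hper.intervalIntegrable₀ Real.two_pi_pos.ne' hint _ _, ?_⟩
  have h1 := hper.intervalIntegral_add_eq (-Real.pi) 0
  rw [show -Real.pi + 2 * Real.pi = Real.pi by ring, zero_add] at h1
  rw [h1, logMahlerMeasure_def, Real.circleAverage_def, smul_eq_mul, one_div]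
  congr 2
  exact hcm.symm

/-- `1 + Q` may vanish on the unit circle, where the logarithm of the quotient need not split
because `Real.log 0 = 0`. -/
lemma ae_eval_exp_ne_zero {p : ℂ[X]} (hp : p ≠ 0) :
    ∀ᵐ θ : ℝ, θ ∈ Set.uIoc (-Real.pi) Real.pi → p.eval (Complex.exp (θ * Complex.I)) ≠ 0 := by
  have hfin : (Complex.arg '' {z | z ∈ p.roots}).Finite :=
    (Multiset.finite_toSet p.roots).image _
  have hnull : ∀ᵐ θ : ℝ, θ ∉ Complex.arg '' {z | z ∈ p.roots} :=
    measure_eq_zero_iff_ae_notMem.1 (hfin.measure_zero volume)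
  filter_upwards [hnull] with θ hθ hmem h0
  rw [Set.uIoc_of_le (by linarith [Real.pi_pos])] at hmem
  refine hθ ⟨Complex.exp (θ * Complex.I), (mem_roots hp).2 h0, ?_⟩
  rw [Complex.exp_mul_I, Complex.arg_cos_add_sin_mul_I hmem]

lemma logMahlerMeasure_map_eq_zero {p : ℝ[X]} (hp : p.Monic)
    (h : ∀ z : ℂ, p.eval₂ (algebraMap ℝ ℂ) z = 0 → ‖z‖ < 1) :
    (p.map (algebraMap ℝ ℂ)).logMahlerMeasure = 0 := by
  have hp' := hp.map (algebraMap ℝ ℂ)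
  rw [logMahlerMeasure_eq_log_leadingCoeff_add_sum_log_roots, hp'.leadingCoeff, norm_one,
    Real.log_one, zero_add]
  refine Multiset.sum_eq_zero fun x hx => ?_
  obtain ⟨z, hz, rfl⟩ := Multiset.mem_map.1 hx
  rw [mem_roots hp'.ne_zero, IsRoot.def, eval_map] at hz
  rw [Real.posLog_eq_zero_iff, abs_norm]
  exact (h z hz).le

/-- The Bode integral of the sensitivity is the sum of the logarithms of the unstable modes. -/
lemma bode_integral {Q : RatFunc ℝ} (hQs : IsStable Q) (hQ : IsStrictlyProper Q) {p m : ℕ}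
    (r : Realization (controller Q) p m) :
    IntervalIntegrable (fun θ : ℝ => Real.logb 2 ‖1 + freqResponse Q θ‖) volume
        (-Real.pi) Real.pi ∧
      (1 / (2 * Real.pi)) *
        ∫ θ in (-Real.pi)..Real.pi, Real.logb 2 ‖1 + freqResponse Q θ‖ = r.rate := by
  obtain ⟨f, g, hf, hg⟩ := Realization.exists_num_add_denom_eq hQ r
  have hnd := num_add_denom_monic hQ
  have hfm : f.Monic := (r.Au.charpoly_monic).of_mul_monic_left (hf ▸ hnd)
  set N := (Q.num + Q.denom).map (algebraMap ℝ ℂ) with hN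
  set D := Q.denom.map (algebraMap ℝ ℂ) with hD
  have hN0 : N ≠ 0 := (hnd.map _).ne_zero
  have hDev : ∀ θ : ℝ, D.eval (Complex.exp (θ * Complex.I)) ≠ 0 := fun θ => by
    rw [hD, eval_map]; exact denom_eval₂_ne_zero hQs θ
  have hae : ∀ᵐ θ : ℝ, θ ∈ Set.uIoc (-Real.pi) Real.pi →
      (Real.log ‖N.eval (Complex.exp (θ * Complex.I))‖ -
        Real.log ‖D.eval (Complex.exp (θ * Complex.I))‖) / Real.log 2 =
      Real.logb 2 ‖1 + freqResponse Q θ‖ := by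
    filter_upwards [ae_eval_exp_ne_zero hN0] with θ hθ hmem
    rw [Real.logb, ← Real.log_div (norm_ne_zero_iff.2 (hθ hmem)) (norm_ne_zero_iff.2 (hDev θ)),
      ← norm_div, freqResponse, RatFunc.eval, ← eval_map, ← eval_map, ← hD, hN, Polynomial.map_add,
      eval_add, ← hD, add_div, div_self (hDev θ), add_comm]
  obtain ⟨hiN, hvN⟩ := logMahlerMeasure_eq_integral N
  obtain ⟨hiD, hvD⟩ := logMahlerMeasure_eq_integral D
  refine ⟨((hiN.sub hiD).div_const (Real.log 2)).congr_ae
    ((ae_restrict_iff' measurableSet_uIoc).2 hae), ?_⟩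
  -- In Jensen's formula each root contributes `log⁺` of its modulus. The roots of `denom` and `f`
  -- contribute nothing, and for those of `A_u` the positive part is the logarithm itself.
  rw [← intervalIntegral.integral_congr_ae hae, intervalIntegral.integral_div,
    intervalIntegral.integral_sub hiN hiD, ← mul_div_assoc, mul_sub, hvN, hvD,
    logMahlerMeasure_map_eq_zero Q.monic_denom hQs, sub_zero, hN, hf, Polynomial.map_mul,
    logMahlerMeasure_mul_eq_add_logMahlerMeasure (mul_ne_zero
      (r.Au.charpoly_monic.map _).ne_zero (hfm.map _).ne_zero),
    logMahlerMeasure_map_eq_zero hfm, add_zero,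
    logMahlerMeasure_eq_log_leadingCoeff_add_sum_log_roots,
    (r.Au.charpoly_monic.map (algebraMap ℝ ℂ)).leadingCoeff, norm_one, Real.log_one, zero_add,
    Realization.rate, ← charpoly_map, ← eigenvalues, div_eq_mul_inv, ← Multiset.sum_map_mul_right]
  · refine congrArg Multiset.sum (Multiset.map_congr rfl fun z hz => ?_)
    rw [Real.posLog_eq_log (by rw [abs_norm]; exact r.unstable z hz), Real.logb, div_eq_mul_inv]
  · intro z hz
    refine r.stable z ((mem_eigenvalues_iff _ _).2 ?_)
    rw [hg, eval₂_mul, hz, zero_mul]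

end Bode

namespace Realization

/-! ### The closed loop -/

section ClosedLoop

open Polynomial

variable {K Q : RatFunc ℝ} {p m : ℕ}

/-- The state of the loop: the decoder state with the encoder state added to its unstable part. -/
def loopState (r : Realization K p m) (x₀ : Fin m → ℝ) (w : ℕ → ℝ) (k : ℕ) : Fin p ⊕ Fin m → ℝ :=
  Sum.elim (r.decoderState x₀ w k).1 ((r.decoderState x₀ w k).2 + r.Au ^ k *ᵥ x₀)

lemma input_eq (r : Realization K p m) (x₀ : Fin m → ℝ) (w : ℕ → ℝ) (k : ℕ) :
    r.input x₀ w k = -(r.outputVec ⬝ᵥ r.loopState x₀ w k) := by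
  rw [input, inputOf, encoderSignal, feedback, outputVec, loopState, sumElim_dotProduct_sumElim,
    dotProduct_add]
  ring

lemma loopState_zero (r : Realization K p m) (x₀ : Fin m → ℝ) (w : ℕ → ℝ) :
    r.loopState x₀ w 0 = Sum.elim (0 : Fin p → ℝ) x₀ := by
  simp [loopState, decoderState]

/-- The encoder state obeys the same `A_u` as the decoder's, so after adding it the encoder signal
no longer appears as a separate input. -/
lemma loopState_succ (r : Realization K p m) (x₀ : Fin m → ℝ) (w : ℕ → ℝ) (k : ℕ) :
    r.loopState x₀ w (k + 1) = r.closedLoop *ᵥ r.loopState x₀ w k + w k • r.inputVec := by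
  have h1 : r.closedLoop *ᵥ r.loopState x₀ w k =
      r.stateMatrix *ᵥ r.loopState x₀ w k + r.input x₀ w k • r.inputVec := by
    rw [closedLoop, Matrix.sub_mulVec, input_eq, vecMulVec_mulVec, sub_eq_add_neg]
    ext i
    simp [mul_comm]
  have h2 : r.loopState x₀ w (k + 1) = r.stateMatrix *ᵥ r.loopState x₀ w k +
      (r.input x₀ w k + w k) • r.inputVec := by
    rw [stateMatrix, loopState, loopState, fromBlocks_mulVec]
    ext (i | i)
    · simp [decoderState, decoderStep, inputVec, input]
    · simp [decoderState, decoderStep, inputVec, input, Matrix.mulVec_add, pow_succ']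
      ring
  rw [h1, h2, add_smul, add_assoc]

lemma loopState_eq (r : Realization K p m) (x₀ : Fin m → ℝ) (w : ℕ → ℝ) (k : ℕ) :
    r.loopState x₀ w k = r.closedLoop ^ k *ᵥ Sum.elim (0 : Fin p → ℝ) x₀ +
      ∑ l ∈ Finset.range k, w l • (r.closedLoop ^ (k - 1 - l) *ᵥ r.inputVec) := by
  induction k with
  | zero => simp [loopState_zero]
  | succ k ih =>
    rw [loopState_succ, ih, Matrix.mulVec_add, Finset.sum_range_succ, Matrix.mulVec_mulVec,
      ← pow_succ', Matrix.mulVec_sum, add_assoc]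
    congr 2
    · refine Finset.sum_congr rfl fun l hl => ?_
      have hl' := Finset.mem_range.1 hl
      rw [Matrix.mulVec_smul, Matrix.mulVec_mulVec, ← pow_succ']
      congr 3
      omega
    · simp

/-- The impulse response of the closed loop from the noise to the channel input. -/
def impulse (r : Realization K p m) (j : ℕ) : ℝ :=
  -(r.outputVec ⬝ᵥ (r.closedLoop ^ j *ᵥ r.inputVec))

/-- The response of the channel input to the encoder initial state. -/
def initialResponse (r : Realization K p m) (x₀ : Fin m → ℝ) (k : ℕ) : ℝ :=
  -(r.outputVec ⬝ᵥ (r.closedLoop ^ k *ᵥ Sum.elim (0 : Fin p → ℝ) x₀))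

lemma input_eq_sum (r : Realization K p m) (x₀ : Fin m → ℝ) (w : ℕ → ℝ) (k : ℕ) :
    r.input x₀ w k = r.initialResponse x₀ k +
      ∑ l ∈ Finset.range k, r.impulse (k - 1 - l) * w l := by
  rw [input_eq, loopState_eq, dotProduct_add, dotProduct_sum, neg_add, initialResponse,
    ← Finset.sum_neg_distrib]
  congr 1
  refine Finset.sum_congr rfl fun l _ => ?_
  rw [dotProduct_smul, impulse, smul_eq_mul]
  ring

lemma eigenvalues_ne_zero (r : Realization K p m) : ∀ z ∈ eigenvalues r.Au, z ≠ 0 :=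
  fun z hz h0 => by simpa [h0] using (r.unstable z hz).trans_lt' zero_lt_one

/-- The estimation error is the loop state, propagated back to time zero. -/
lemma estimate_eq (r : Realization K p m) (x₀ : Fin m → ℝ) (w : ℕ → ℝ) (n : ℕ) :
    r.estimate x₀ w n = x₀ - r.Au⁻¹ ^ n *ᵥ fun i => r.loopState x₀ w n (Sum.inr i) := by
  have hdet := isUnit_det_of_eigenvalues_ne_zero r.Au r.eigenvalues_ne_zero
  have h4 : r.Au⁻¹ ^ n * r.Au ^ n = 1 := by
    rw [Matrix.inv_pow', Matrix.nonsing_inv_mul _ (by rw [Matrix.det_pow]; exact hdet.pow n)]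
  have h5 : (fun i => r.loopState x₀ w n (Sum.inr i)) =
      (r.decoderState x₀ w n).2 + r.Au ^ n *ᵥ x₀ := by
    ext i; simp [loopState]
  rw [estimate, h5, Matrix.mulVec_add, Matrix.mulVec_mulVec, h4, Matrix.one_mulVec]
  abel

end ClosedLoop

end Realization

/-! ### Uniform bounds for the closed loop -/

lemma abs_mulVec_le {ι : Type*} [Fintype ι] {A : Matrix ι ι ℝ} {c : ℝ} (hA : ∀ i j, |A i j| ≤ c)
    (v : ι → ℝ) (i : ι) : |(A *ᵥ v) i| ≤ c * ∑ j, |v j| := by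
  rw [Matrix.mulVec, dotProduct, Finset.mul_sum]
  refine (Finset.abs_sum_le_sum_abs _ _).trans (Finset.sum_le_sum fun j _ => ?_)
  rw [abs_mul]
  exact mul_le_mul_of_nonneg_right (hA i j) (abs_nonneg _)

lemma abs_dotProduct_le {ι : Type*} [Fintype ι] (c v : ι → ℝ) {b : ℝ} (hv : ∀ i, |v i| ≤ b) :
    |c ⬝ᵥ v| ≤ (∑ i, |c i|) * b := by
  rw [dotProduct, Finset.sum_mul]
  refine (Finset.abs_sum_le_sum_abs _ _).trans (Finset.sum_le_sum fun j _ => ?_)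
  rw [abs_mul]
  exact mul_le_mul_of_nonneg_left (hv j) (abs_nonneg _)

namespace Realization

section Bounds

variable {Q : RatFunc ℝ} {p m : ℕ}

/-- The loop state is bounded, uniformly in time, by the initial state and the noise. -/
lemma exists_abs_loopState_le (hQs : IsStable Q) (hQ : IsStrictlyProper Q)
    (r : Realization (controller Q) p m) (B : ℝ) :
    ∃ M : ℝ, 0 ≤ M ∧ ∀ (x₀ : Fin m → ℝ) (w : ℕ → ℝ) (n : ℕ) (t : ℝ), 0 ≤ t →
      ∑ i, |x₀ i| ≤ B → (∀ l < n, |w l| ≤ t) → ∀ i, |r.loopState x₀ w n i| ≤ M * (1 + t) := by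
  obtain ⟨ρ, hρ0, hρ1, C, hC, hF⟩ := exists_abs_pow_apply_le r.closedLoop
    (r.closedLoop_stable hQs hQ)
  set b := ∑ i, |r.inputVec i| with hb
  have hb0 : 0 ≤ b := Finset.sum_nonneg fun i _ => abs_nonneg _
  -- The first term bounds the response to the initial state, the second the geometric series of
  -- responses to the noise.
  refine ⟨C * |B| + C * b / (1 - ρ), by
    have := sub_pos.2 hρ1
    positivity, fun x₀ w n t ht hx hw i => ?_⟩
  have h1 : |(r.closedLoop ^ n *ᵥ Sum.elim (0 : Fin p → ℝ) x₀) i| ≤ C * |B| := by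
    refine (abs_mulVec_le (hF n) _ i).trans ?_
    simp only [Fintype.sum_sum_type, Sum.elim_inl, Sum.elim_inr, Pi.zero_apply, abs_zero,
      Finset.sum_const_zero, zero_add]
    refine mul_le_mul (mul_le_of_le_one_right hC (pow_le_one₀ hρ0.le hρ1.le))
      (hx.trans (le_abs_self B)) (Finset.sum_nonneg fun i _ => abs_nonneg (x₀ i)) hC
  have h2 : |(∑ l ∈ Finset.range n, w l • (r.closedLoop ^ (n - 1 - l) *ᵥ r.inputVec)) i| ≤
      C * b / (1 - ρ) * t := by
    rw [Finset.sum_apply]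
    refine (Finset.abs_sum_le_sum_abs _ _).trans ?_
    calc ∑ l ∈ Finset.range n, |(w l • (r.closedLoop ^ (n - 1 - l) *ᵥ r.inputVec)) i|
        ≤ ∑ l ∈ Finset.range n, t * (C * ρ ^ (n - 1 - l) * b) := by
          refine Finset.sum_le_sum fun l hl => ?_
          rw [Pi.smul_apply, smul_eq_mul, abs_mul]
          exact mul_le_mul (hw l (Finset.mem_range.1 hl)) (abs_mulVec_le (hF _) _ i)
            (abs_nonneg _) ht
      _ = t * (C * b * ∑ l ∈ Finset.range n, ρ ^ (n - 1 - l)) := by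
          rw [Finset.mul_sum, Finset.mul_sum]
          exact Finset.sum_congr rfl fun l _ => by ring
      _ ≤ t * (C * b * (1 - ρ)⁻¹) := by
          rw [Finset.sum_range_reflect fun l => ρ ^ l]
          gcongr
          rw [← tsum_geometric_of_lt_one hρ0.le hρ1]
          exact (summable_geometric_of_lt_one hρ0.le hρ1).sum_le_tsum _
            fun l _ => pow_nonneg hρ0.le l
      _ = C * b / (1 - ρ) * t := by ring
  rw [loopState_eq, Pi.add_apply]
  have h3 : 0 ≤ C * b / (1 - ρ) := by
    have := sub_pos.2 hρ1
    positivity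
  have h4 : 0 ≤ C * |B| * t := by positivity
  refine (abs_add_le _ _).trans ((add_le_add h1 h2).trans ?_)
  nlinarith

lemma exists_abs_impulse_initialResponse_le (hQs : IsStable Q) (hQ : IsStrictlyProper Q)
    (r : Realization (controller Q) p m) (B : ℝ) :
    ∃ M ρ : ℝ, 0 ≤ M ∧ 0 < ρ ∧ ρ < 1 ∧ (∀ j, |r.impulse j| ≤ M * ρ ^ j) ∧
      ∀ (x₀ : Fin m → ℝ) (k : ℕ), ∑ i, |x₀ i| ≤ B → |r.initialResponse x₀ k| ≤ M * ρ ^ k := by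
  obtain ⟨ρ, hρ0, hρ1, C, hC, hF⟩ := exists_abs_pow_apply_le r.closedLoop
    (r.closedLoop_stable hQs hQ)
  set b := ∑ i, |r.inputVec i| with hb
  have hb0 : 0 ≤ b := Finset.sum_nonneg fun i _ => abs_nonneg _
  set c := ∑ i, |r.outputVec i| with hc
  have hc0 : 0 ≤ c := Finset.sum_nonneg fun i _ => abs_nonneg _
  refine ⟨c * (C * (b + |B|)), ρ, by positivity, hρ0, hρ1, fun j => ?_, fun x₀ k hx => ?_⟩
  · rw [impulse, abs_neg]
    refine (abs_dotProduct_le _ _ (abs_mulVec_le (hF j) _)).trans ?_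
    have : 0 ≤ c * (C * |B|) * ρ ^ j := by positivity
    nlinarith
  · rw [initialResponse, abs_neg]
    refine (abs_dotProduct_le _ _ (abs_mulVec_le (hF k) _)).trans ?_
    have h1 : ∑ i, |Sum.elim (0 : Fin p → ℝ) x₀ i| = ∑ i, |x₀ i| := by
      simp [Fintype.sum_sum_type]
    rw [h1]
    calc c * (C * ρ ^ k * ∑ i, |x₀ i|) ≤ c * (C * ρ ^ k * (b + |B|)) := by
          gcongr
          exact (hx.trans (le_abs_self B)).trans (by linarith)
      _ = c * (C * (b + |B|)) * ρ ^ k := by ring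

end Bounds

/-! ### Frequency response of the closed loop -/

section Frequency

open Polynomial

variable {Q : RatFunc ℝ} {p m : ℕ}

lemma eval₂_transferNum {ι : Type*} [Fintype ι] [DecidableEq ι] (A : Matrix ι ι ℝ) (B C : ι → ℝ)
    (z : ℂ) : (transferNum A B C).eval₂ (algebraMap ℝ ℂ) z =
      (fun i => (C i : ℂ)) ⬝ᵥ ((Matrix.scalar ι z - A.map (algebraMap ℝ ℂ)).adjugate *ᵥ
        fun i => (B i : ℂ)) := by
  have h1 : (charmatrix A).map (eval₂RingHom (algebraMap ℝ ℂ) z) =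
      Matrix.scalar ι z - A.map (algebraMap ℝ ℂ) := by
    ext i j
    by_cases h : i = j
    · subst h; simp
    · simp [h]
  have h2 : ∀ a : ℝ, eval₂RingHom (algebraMap ℝ ℂ) z (Polynomial.C a) = a := fun a => by simp
  rw [← h1, ← RingHom.mapMatrix_apply, ← RingHom.map_adjugate, ← coe_eval₂RingHom, transferNum]
  simp only [dotProduct, Matrix.mulVec, map_sum, map_mul, h2, RingHom.mapMatrix_apply,
    Matrix.map_apply]

/-- The Neumann series of the resolvent, truncated, with its telescoped remainder. -/
lemma scalar_sub_mulVec_sum {ι : Type*} [Fintype ι] [DecidableEq ι] (A : Matrix ι ι ℂ)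
    (b : ι → ℂ) {z : ℂ} (hz : z ≠ 0) (k : ℕ) :
    (Matrix.scalar ι z - A) *ᵥ (∑ j ∈ Finset.range k, (z⁻¹) ^ (j + 1) • (A ^ j *ᵥ b)) =
      b - (z⁻¹) ^ k • (A ^ k *ᵥ b) := by
  induction k with
  | zero => simp
  | succ k ih =>
    have hscal : ∀ y : ι → ℂ, Matrix.scalar ι z *ᵥ y = z • y := by
      intro y; ext i; simp [Matrix.mulVec_diagonal]
    rw [Finset.sum_range_succ, Matrix.mulVec_add, ih, Matrix.mulVec_smul, Matrix.sub_mulVec, hscal,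
      Matrix.mulVec_mulVec, ← pow_succ', smul_sub, smul_smul]
    have : z⁻¹ ^ (k + 1) * z = z⁻¹ ^ k := by
      rw [pow_succ, mul_assoc, inv_mul_cancel₀ hz, mul_one]
    rw [this]
    abel

/-- The impulse response of the closed loop is that of `Q`. -/
lemma tendsto_sum_impulse (hQs : IsStable Q) (hQ : IsStrictlyProper Q)
    (r : Realization (controller Q) p m) (θ : ℝ) :
    Tendsto (fun k => ∑ j ∈ Finset.range k,
      (r.impulse j : ℂ) * ((Complex.exp (θ * Complex.I))⁻¹) ^ (j + 1)) atTop
      (nhds (freqResponse Q θ)) := by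
  set z := Complex.exp (θ * Complex.I) with hz
  have hz0 : z ≠ 0 := Complex.exp_ne_zero _
  have hznorm : ‖z⁻¹‖ = 1 := by rw [norm_inv, hz, Complex.norm_exp_ofReal_mul_I, inv_one]
  set φ := algebraMap ℝ ℂ with hφ
  set A := r.closedLoop.map φ with hA
  set b : Fin p ⊕ Fin m → ℂ := fun i => (r.inputVec i : ℂ) with hb
  set c : Fin p ⊕ Fin m → ℂ := fun i => (r.outputVec i : ℂ) with hc
  set χ := r.closedLoop.charpoly.eval₂ φ z with hχ
  have hχ0 : χ ≠ 0 := fun h => by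
    have := r.closedLoop_stable hQs hQ z h
    rw [hz, Complex.norm_exp_ofReal_mul_I] at this
    exact lt_irrefl _ this
  have hχdet : χ = (Matrix.scalar (Fin p ⊕ Fin m) z - A).det := by
    rw [hχ, ← Polynomial.eval_map, ← Matrix.charpoly_map, Matrix.eval_charpoly]
  have himp : ∀ j, (r.impulse j : ℂ) = -(c ⬝ᵥ (A ^ j *ᵥ b)) := by
    intro j
    rw [hA, ← Matrix.map_pow]
    simp [impulse, dotProduct, Matrix.mulVec, hc, hb, hφ]
  have hsum : ∀ k, ∑ j ∈ Finset.range k, (r.impulse j : ℂ) * z⁻¹ ^ (j + 1) =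
      -(c ⬝ᵥ ∑ j ∈ Finset.range k, (z⁻¹) ^ (j + 1) • (A ^ j *ᵥ b)) := by
    intro k
    rw [dotProduct_sum, ← Finset.sum_neg_distrib]
    refine Finset.sum_congr rfl fun j _ => ?_
    rw [himp, dotProduct_smul, smul_eq_mul]
    ring
  set adj := (Matrix.scalar (Fin p ⊕ Fin m) z - A).adjugate with hadj
  -- Applying the adjugate turns the truncated series into an exact formula for `χ` times the
  -- partial sum. Its remainder decays, and `χ ≠ 0` because `|z| = 1`.
  have hmul : ∀ k, χ * (∑ j ∈ Finset.range k, (r.impulse j : ℂ) * z⁻¹ ^ (j + 1)) =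
      -(c ⬝ᵥ (adj *ᵥ b)) + z⁻¹ ^ k * (c ⬝ᵥ (adj *ᵥ (A ^ k *ᵥ b))) := by
    intro k
    have h1 := congrArg (fun y => adj *ᵥ y) (scalar_sub_mulVec_sum A b hz0 k)
    simp only [Matrix.mulVec_mulVec] at h1
    rw [hadj, Matrix.adjugate_mul, ← hχdet, Matrix.smul_mulVec, Matrix.one_mulVec] at h1
    rw [hsum, mul_neg, ← smul_eq_mul, ← dotProduct_smul, h1, ← hadj, Matrix.mulVec_sub,
      Matrix.mulVec_smul, dotProduct_sub, dotProduct_smul, smul_eq_mul]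
    ring
  have hlim : Tendsto (fun k => z⁻¹ ^ k * (c ⬝ᵥ (adj *ᵥ (A ^ k *ᵥ b)))) atTop (nhds 0) := by
    obtain ⟨ρ, hρ0, hρ1, C, hC, hF⟩ := exists_abs_pow_apply_le r.closedLoop
      (r.closedLoop_stable hQs hQ)
    have hent : ∀ i, Tendsto (fun k => (A ^ k *ᵥ b) i) atTop (nhds 0) := by
      intro i
      have h1 : ∀ k, ‖(A ^ k *ᵥ b) i‖ ≤ C * ρ ^ k * ∑ j, |r.inputVec j| := by
        intro k
        have : (A ^ k *ᵥ b) i = (((r.closedLoop ^ k *ᵥ r.inputVec) i : ℝ) : ℂ) := by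
          rw [hA, ← Matrix.map_pow]
          simp [dotProduct, Matrix.mulVec, hb, hφ]
        rw [this, Complex.norm_real, Real.norm_eq_abs]
        exact abs_mulVec_le (hF k) _ i
      refine squeeze_zero_norm h1 ?_
      have := ((tendsto_pow_atTop_nhds_zero_of_lt_one hρ0.le hρ1).const_mul C).mul_const
        (∑ j, |r.inputVec j|)
      simpa using this
    have h2 : Tendsto (fun k => c ⬝ᵥ (adj *ᵥ (A ^ k *ᵥ b))) atTop (nhds 0) := by
      have h3 : Tendsto (fun k => A ^ k *ᵥ b) atTop (nhds 0) := tendsto_pi_nhds.2 hent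
      have h4 : Continuous fun y : Fin p ⊕ Fin m → ℂ => c ⬝ᵥ (adj *ᵥ y) := by fun_prop
      have := (h4.tendsto 0).comp h3
      rw [Matrix.mulVec_zero, dotProduct_zero] at this
      exact this
    refine squeeze_zero_norm (fun k => ?_) (tendsto_zero_iff_norm_tendsto_zero.1 h2)
    rw [norm_mul, norm_pow, hznorm, one_pow, one_mul]
  have hval : freqResponse Q θ = χ⁻¹ * (-(c ⬝ᵥ (adj *ᵥ b))) := by
    have h1 := congrArg (fun f => f.eval₂ φ z) (r.transferNum_closedLoop_mul hQ)
    simp only [eval₂_mul, eval₂_neg] at h1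
    rw [eval₂_transferNum, ← hφ, ← hA, ← hadj, ← hχ] at h1
    have hd : Q.denom.eval₂ φ z ≠ 0 := denom_eval₂_ne_zero hQs θ
    rw [freqResponse, RatFunc.eval, ← hz, ← hφ, div_eq_iff hd]
    rw [mul_assoc, h1, mul_comm (eval₂ φ z Q.num), inv_mul_cancel_left₀ hχ0]
  rw [hval]
  have h5 := (hlim.const_add (-(c ⬝ᵥ (adj *ᵥ b)))).const_mul χ⁻¹
  rw [add_zero] at h5
  refine h5.congr fun k => ?_
  rw [← hmul, inv_mul_cancel_left₀ hχ0]

end Frequency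

end Realization

/-! ### Transmission power -/

lemma continuous_freqResponse {F : RatFunc ℝ} (hF : IsStable F) : Continuous (freqResponse F) := by
  have h1 : ∀ g : Polynomial ℝ, Continuous fun θ : ℝ =>
      g.eval₂ (algebraMap ℝ ℂ) (Complex.exp (θ * Complex.I)) := by
    intro g
    simp_rw [← Polynomial.eval_map]
    fun_prop
  exact (h1 _).div (h1 _) (denom_eval₂_ne_zero hF)

lemma continuous_spectralDensity {H : RatFunc ℝ} (hH : IsStable H) :
    Continuous (spectralDensity H) :=
  ((continuous_freqResponse hH).norm).pow 2

/-- The cosines are those of the autocovariance formula, so integrating against the density yields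
the variance of `∑ c l * W l`. -/
lemma norm_sq_trigSum (s : Finset ℕ) (c : ℕ → ℝ) (θ : ℝ) :
    ‖∑ l ∈ s, (c l : ℂ) * Complex.exp ((l * θ : ℝ) * Complex.I)‖ ^ 2 =
      ∑ i ∈ s, ∑ j ∈ s, c i * c j * Real.cos (((i : ℝ) - (j : ℝ)) * θ) := by
  have hre : (∑ l ∈ s, (c l : ℂ) * Complex.exp ((l * θ : ℝ) * Complex.I)).re =
      ∑ l ∈ s, c l * Real.cos (l * θ) := by
    rw [Complex.re_sum]
    exact Finset.sum_congr rfl fun l _ => by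
      rw [Complex.re_ofReal_mul, Complex.exp_ofReal_mul_I_re]
  have him : (∑ l ∈ s, (c l : ℂ) * Complex.exp ((l * θ : ℝ) * Complex.I)).im =
      ∑ l ∈ s, c l * Real.sin (l * θ) := by
    rw [Complex.im_sum]
    exact Finset.sum_congr rfl fun l _ => by
      rw [Complex.im_ofReal_mul, Complex.exp_ofReal_mul_I_im]
  rw [Complex.sq_norm, Complex.normSq_apply, hre, him, Finset.sum_mul_sum, Finset.sum_mul_sum,
    ← Finset.sum_add_distrib]
  refine Finset.sum_congr rfl fun i _ => ?_
  rw [← Finset.sum_add_distrib]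
  refine Finset.sum_congr rfl fun j _ => ?_
  rw [sub_mul, Real.cos_sub]
  ring

section Noise

variable {Ω : Type*} [MeasurableSpace Ω] {μ : Measure Ω} {H : RatFunc ℝ} {W : ℕ → Ω → ℝ}

lemma IsStationaryGaussianNoise.memLp_two (hW : IsStationaryGaussianNoise H W μ) (k : ℕ) :
    MemLp (W k) 2 μ :=
  (hW.gaussian.hasGaussianLaw_eval k).memLp_two

variable [IsProbabilityMeasure μ]

lemma IsStationaryGaussianNoise.integral_mul (hW : IsStationaryGaussianNoise H W μ) (i j : ℕ) :
    ∫ ω, W i ω * W j ω ∂μ = (1 / (2 * Real.pi)) *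
      ∫ θ in (-Real.pi)..Real.pi, Real.cos (((i : ℝ) - (j : ℝ)) * θ) * spectralDensity H θ := by
  rw [← hW.cov_eq, covariance_eq_sub (hW.memLp_two i) (hW.memLp_two j), hW.mean_zero, zero_mul,
    sub_zero]
  rfl

/-- The second moment of a filtered noise, in the frequency domain. -/
lemma IsStationaryGaussianNoise.integral_sq_const_add_sum (hH : IsStable H)
    (hW : IsStationaryGaussianNoise H W μ) (a : ℝ) (s : Finset ℕ) (c : ℕ → ℝ) :
    ∫ ω, (a + ∑ l ∈ s, c l * W l ω) ^ 2 ∂μ = a ^ 2 + (1 / (2 * Real.pi)) *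
      ∫ θ in (-Real.pi)..Real.pi,
        ‖∑ l ∈ s, (c l : ℂ) * Complex.exp ((l * θ : ℝ) * Complex.I)‖ ^ 2 *
          spectralDensity H θ := by
  have hS := continuous_spectralDensity hH
  have hint : ∀ l, Integrable (W l) μ := fun l => (hW.memLp_two l).integrable one_le_two
  have hint2 : ∀ i j, Integrable (fun ω => W i ω * W j ω) μ := fun i j =>
    (hW.memLp_two i).integrable_mul (hW.memLp_two j)
  have hlin : Integrable (fun ω => ∑ l ∈ s, c l * W l ω) μ :=
    integrable_finsetSum _ fun l _ => (hint l).const_mul _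
  have hsq : ∀ ω, (∑ l ∈ s, c l * W l ω) ^ 2 =
      ∑ i ∈ s, ∑ j ∈ s, c i * c j * (W i ω * W j ω) := by
    intro ω
    rw [sq, Finset.sum_mul_sum]
    exact Finset.sum_congr rfl fun i _ => Finset.sum_congr rfl fun j _ => by ring
  have hI1 : ∫ ω, (∑ l ∈ s, c l * W l ω) ∂μ = 0 := by
    rw [integral_finsetSum _ fun l _ => (hint l).const_mul _]
    exact Finset.sum_eq_zero fun l _ => by rw [integral_const_mul, hW.mean_zero, mul_zero]
  have hintsq : Integrable (fun ω => ∑ i ∈ s, ∑ j ∈ s, c i * c j * (W i ω * W j ω)) μ :=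
    integrable_finsetSum _ fun i _ => integrable_finsetSum _ fun j _ => (hint2 i j).const_mul _
  have hI2 : ∫ ω, ∑ i ∈ s, ∑ j ∈ s, c i * c j * (W i ω * W j ω) ∂μ =
      ∑ i ∈ s, ∑ j ∈ s, c i * c j * ∫ ω, W i ω * W j ω ∂μ := by
    rw [integral_finsetSum _ fun i _ =>
      integrable_finsetSum _ fun j _ => (hint2 i j).const_mul _]
    refine Finset.sum_congr rfl fun i _ => ?_
    rw [integral_finsetSum _ fun j _ => (hint2 i j).const_mul _]
    exact Finset.sum_congr rfl fun j _ => integral_const_mul _ _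
  have hexp : ∀ ω, (a + ∑ l ∈ s, c l * W l ω) ^ 2 =
      (a ^ 2 + 2 * a * ∑ l ∈ s, c l * W l ω) +
        ∑ i ∈ s, ∑ j ∈ s, c i * c j * (W i ω * W j ω) := fun ω => by rw [← hsq]; ring
  simp_rw [hexp, norm_sq_trigSum]
  have hconst : Integrable (fun ω => a ^ 2 + 2 * a * ∑ l ∈ s, c l * W l ω) μ :=
    (integrable_const _).add (hlin.const_mul _)
  rw [integral_add hconst hintsq, integral_add (integrable_const _) (hlin.const_mul _), integral_const_mul, hI1, hI2,
    integral_const, probReal_univ, one_smul, mul_zero, add_zero]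
  congr 1
  have hcont : ∀ i j : ℕ, IntervalIntegrable
      (fun θ => c i * c j * Real.cos (((i : ℝ) - (j : ℝ)) * θ) * spectralDensity H θ) volume
      (-Real.pi) Real.pi := fun i j => by
    refine Continuous.intervalIntegrable ?_ _ _
    fun_prop
  simp_rw [Finset.sum_mul]
  rw [intervalIntegral.integral_finsetSum fun i _ => by
    refine Continuous.intervalIntegrable ?_ _ _
    fun_prop, Finset.mul_sum]
  refine Finset.sum_congr rfl fun i _ => ?_
  rw [intervalIntegral.integral_finsetSum fun j _ => hcont i j, Finset.mul_sum]
  refine Finset.sum_congr rfl fun j _ => ?_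
  rw [hW.integral_mul]
  simp_rw [mul_assoc (c i * c j)]
  rw [intervalIntegral.integral_const_mul]
  ring

end Noise

section Power

variable {Q H : RatFunc ℝ} {p m : ℕ}

/-- The frequency response of the first `k` terms of the impulse response. -/
noncomputable def truncatedResponse (g : ℕ → ℝ) (k : ℕ) (θ : ℝ) : ℂ :=
  ∑ j ∈ Finset.range k, (g j : ℂ) * ((Complex.exp (θ * Complex.I))⁻¹) ^ (j + 1)

/-- The input is a convolution, so the coefficients come in reversed order; undoing the reversal
costs only the unimodular factor `zᵏ`. -/
lemma norm_trigSum_reflect (g : ℕ → ℝ) (k : ℕ) (θ : ℝ) :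
    ‖∑ l ∈ Finset.range k, (g (k - 1 - l) : ℂ) * Complex.exp ((l * θ : ℝ) * Complex.I)‖ =
      ‖truncatedResponse g k θ‖ := by
  set z := Complex.exp (θ * Complex.I) with hz
  have hz0 : z ≠ 0 := Complex.exp_ne_zero _
  have h1 : ∑ l ∈ Finset.range k, (g (k - 1 - l) : ℂ) * Complex.exp ((l * θ : ℝ) * Complex.I) =
      z ^ k * truncatedResponse g k θ := by
    rw [← Finset.sum_range_reflect, truncatedResponse, Finset.mul_sum]
    refine Finset.sum_congr rfl fun j hj => ?_
    have hj' := Finset.mem_range.1 hj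
    have h2 : k - 1 - (k - 1 - j) = j := by omega
    have h3 : Complex.exp (((k - 1 - j : ℕ) * θ : ℝ) * Complex.I) = z ^ (k - 1 - j) := by
      rw [hz, ← Complex.exp_nat_mul]
      push_cast
      ring_nf
    have h4 : z ^ k = z ^ (k - 1 - j) * z ^ (j + 1) := by
      rw [← pow_add]; congr 1; omega
    rw [h2, h3, h4, ← hz, inv_pow]
    field_simp
  rw [h1, norm_mul, norm_pow, hz, Complex.norm_exp_ofReal_mul_I, one_pow, one_mul]

/-- Dominated convergence: the impulse response is bounded by a geometric series, uniformly in `θ`.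
-/
lemma tendsto_integral_truncatedResponse (hQs : IsStable Q) (hQ : IsStrictlyProper Q)
    (hH : IsStable H) (r : Realization (controller Q) p m) :
    Tendsto (fun k => (1 / (2 * Real.pi)) * ∫ θ in (-Real.pi)..Real.pi,
        ‖truncatedResponse r.impulse k θ‖ ^ 2 * spectralDensity H θ) atTop
      (nhds ((1 / (2 * Real.pi)) * ∫ θ in (-Real.pi)..Real.pi,
        ‖freqResponse Q θ‖ ^ 2 * spectralDensity H θ)) := by
  obtain ⟨M, ρ, hM, hρ0, hρ1, himp, -⟩ := r.exists_abs_impulse_initialResponse_le hQs hQ 0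
  have hS := continuous_spectralDensity hH
  have hbound : ∀ k θ, ‖truncatedResponse r.impulse k θ‖ ≤ M * (1 - ρ)⁻¹ := by
    intro k θ
    refine (norm_sum_le _ _).trans ?_
    calc ∑ j ∈ Finset.range k, ‖(r.impulse j : ℂ) * ((Complex.exp (θ * Complex.I))⁻¹) ^ (j + 1)‖
        ≤ ∑ j ∈ Finset.range k, M * ρ ^ j := by
          refine Finset.sum_le_sum fun j _ => ?_
          rw [norm_mul, norm_pow, norm_inv, Complex.norm_exp_ofReal_mul_I, inv_one, one_pow, mul_one,
            Complex.norm_real]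
          exact himp j
      _ ≤ M * (1 - ρ)⁻¹ := by
          rw [← Finset.mul_sum, ← tsum_geometric_of_lt_one hρ0.le hρ1]
          exact mul_le_mul_of_nonneg_left ((summable_geometric_of_lt_one hρ0.le hρ1).sum_le_tsum _
            fun l _ => pow_nonneg hρ0.le l) hM
  have hcont : ∀ k, Continuous (truncatedResponse r.impulse k) := by
    intro k
    unfold truncatedResponse
    refine continuous_finsetSum _ fun j _ => continuous_const.mul (Continuous.pow ?_ _)
    exact Continuous.inv₀ (by fun_prop) fun θ => Complex.exp_ne_zero _
  refine Tendsto.const_mul _ ?_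
  refine intervalIntegral.tendsto_integral_filter_of_dominated_convergence
    (fun θ => (M * (1 - ρ)⁻¹) ^ 2 * spectralDensity H θ) ?_ ?_ ?_ ?_
  · exact Eventually.of_forall fun k => (((hcont k).norm.pow 2).mul hS).aestronglyMeasurable
  · refine Eventually.of_forall fun k => Eventually.of_forall fun θ _ => ?_
    have h0 : 0 ≤ spectralDensity H θ := sq_nonneg _
    rw [Real.norm_eq_abs, abs_of_nonneg (by positivity)]
    gcongr
    exact hbound k θ
  · exact (continuous_const.mul hS).intervalIntegrable _ _
  · refine Eventually.of_forall fun θ _ => ?_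
    exact (((r.tendsto_sum_impulse hQs hQ θ).norm).pow 2).mul_const _

variable {Ω : Type*} [MeasurableSpace Ω] {μ : Measure Ω} [IsProbabilityMeasure μ] {W : ℕ → Ω → ℝ}

lemma sum_abs_messagePoint_le (P : Matrix (Fin m) (Fin m) ℝ) (N : Fin m → ℕ)
    (j : (i : Fin m) → Fin (N i)) :
    ∑ i, |messagePoint P N j i| ≤ ∑ i, ∑ l, |P i l| := by
  refine Finset.sum_le_sum fun i _ => ?_
  rw [messagePoint, Matrix.mulVec, dotProduct]
  refine (Finset.abs_sum_le_sum_abs _ _).trans (Finset.sum_le_sum fun l _ => ?_)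
  rw [abs_mul]
  refine mul_le_of_le_one_right (abs_nonneg _) ?_
  have hj : ((j l : ℕ) : ℝ) + 1 ≤ N l := by exact_mod_cast (j l).2
  have hN : (0 : ℝ) < N l := lt_of_lt_of_le (by positivity) hj
  rw [abs_of_nonneg (by positivity), div_le_one hN]
  linarith

/-- The average power converges, uniformly over the messages of any constellations. -/
lemma eventually_abs_averagePower_sub_lt (hQs : IsStable Q) (hQ : IsStrictlyProper Q)
    (hH : IsStable H) (hW : IsStationaryGaussianNoise H W μ)
    (r : Realization (controller Q) p m) (P : Matrix (Fin m) (Fin m) ℝ) (N : ℕ → Fin m → ℕ)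
    {ε : ℝ} (hε : 0 < ε) :
    ∀ᶠ n : ℕ in atTop, ∀ j : (i : Fin m) → Fin (N n i),
      |averagePower r W μ P (N n) j n - (1 / (2 * Real.pi)) *
        ∫ θ in (-Real.pi)..Real.pi, ‖freqResponse Q θ‖ ^ 2 * spectralDensity H θ| < ε := by
  set L := (1 / (2 * Real.pi)) *
    ∫ θ in (-Real.pi)..Real.pi, ‖freqResponse Q θ‖ ^ 2 * spectralDensity H θ with hL
  set T : ℕ → ℝ := fun k => (1 / (2 * Real.pi)) * ∫ θ in (-Real.pi)..Real.pi,
    ‖truncatedResponse r.impulse k θ‖ ^ 2 * spectralDensity H θ with hT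
  obtain ⟨M, ρ, hM, hρ0, hρ1, -, hinit⟩ :=
    r.exists_abs_impulse_initialResponse_le hQs hQ (∑ i, ∑ l, |P i l|)
  have hces : Tendsto (fun n : ℕ => (n⁻¹ : ℝ) * ∑ k ∈ Finset.range n, T k) atTop (nhds L) :=
    (tendsto_integral_truncatedResponse hQs hQ hH r).cesaro
  have hces0 : Tendsto (fun n : ℕ => (n⁻¹ : ℝ) * ∑ k ∈ Finset.range n, (M * ρ ^ k) ^ 2) atTop
      (nhds 0) := by
    refine Tendsto.cesaro ?_
    have := ((tendsto_pow_atTop_nhds_zero_of_lt_one hρ0.le hρ1).const_mul M).pow 2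
    simpa using this
  have h1 := (tendsto_order.1 (tendsto_iff_dist_tendsto_zero.1 hces)).2 (ε / 2) (half_pos hε)
  have h2 := (tendsto_order.1 hces0).2 (ε / 2) (half_pos hε)
  filter_upwards [h1, h2] with n hn1 hn2 j
  -- The noise has mean zero, so there is no cross term. Only the first sum depends on the message,
  -- and its bound `(M ρᵏ)²` does not, whence the uniformity.
  have hpow : averagePower r W μ P (N n) j n =
      (n⁻¹ : ℝ) * ∑ k ∈ Finset.range n, r.initialResponse (messagePoint P (N n) j) k ^ 2 +
        (n⁻¹ : ℝ) * ∑ k ∈ Finset.range n, T k := by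
    rw [averagePower, one_div, ← mul_add, ← Finset.sum_add_distrib]
    congr 1
    refine Finset.sum_congr rfl fun k _ => ?_
    simp_rw [Realization.input_eq_sum]
    rw [hW.integral_sq_const_add_sum hH]
    simp_rw [norm_trigSum_reflect]
    rfl
  have hnonneg : 0 ≤ (n⁻¹ : ℝ) *
      ∑ k ∈ Finset.range n, r.initialResponse (messagePoint P (N n) j) k ^ 2 := by positivity
  have hle : (n⁻¹ : ℝ) * ∑ k ∈ Finset.range n, r.initialResponse (messagePoint P (N n) j) k ^ 2 ≤
      (n⁻¹ : ℝ) * ∑ k ∈ Finset.range n, (M * ρ ^ k) ^ 2 := by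
    refine mul_le_mul_of_nonneg_left (Finset.sum_le_sum fun k _ => ?_) (by positivity)
    rw [← sq_abs]
    exact pow_le_pow_left₀ (abs_nonneg _) (hinit _ k (sum_abs_messagePoint_le P (N n) j)) 2
  rw [Real.dist_eq, abs_lt] at hn1
  rw [hpow, abs_lt]
  constructor <;> linarith [hn1.1, hn1.2]

end Power

/-! ### Decoding errors -/

/-- An error below half a cell width stays in the cell. A direction with a single cell needs no
accuracy, since clamping sends every estimate there. -/
lemma decode_eq {m : ℕ} (P : Matrix (Fin m) (Fin m) ℝ) (N : Fin m → ℕ)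
    (j : (i : Fin m) → Fin (N i)) (x : Fin m → ℝ)
    (h : ∀ i, N i = 1 ∨
      |(P⁻¹ *ᵥ x) i - (((j i : ℕ) : ℝ) + 1 / 2) / (N i : ℝ)| * (2 * N i) < 1) :
    decode P N x = fun i => (j i : ℕ) := by
  ext i
  have hj := (j i).2
  rw [decode]
  rcases h i with h1 | h1
  · have h2 : (j i : ℕ) = 0 := by omega
    rw [h2, h1]
    simp
  · have hN : (0 : ℝ) < N i := by exact_mod_cast (Nat.zero_le _).trans_lt hj
    set e := (P⁻¹ *ᵥ x) i - (((j i : ℕ) : ℝ) + 1 / 2) / (N i : ℝ) with he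
    have h3 : (N i : ℝ) * (P⁻¹ *ᵥ x) i = (j i : ℕ) + 1 / 2 + N i * e := by
      rw [he]; field_simp; ring
    have h4 : |N i * e| < 1 / 2 := by
      rw [abs_mul, abs_of_pos hN]; linarith
    have h5 := abs_lt.1 h4
    have h6 : ⌊(N i : ℝ) * (P⁻¹ *ᵥ x) i⌋₊ = (j i : ℕ) := by
      rw [Nat.floor_eq_iff (by rw [h3]; linarith [h5.1, (Nat.cast_nonneg (j i : ℕ) : (0 : ℝ) ≤ _)]),
        h3]
      constructor <;> linarith [h5.1, h5.2]
    rw [h6]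
    omega

lemma errorProb_le {Ω : Type*} [MeasurableSpace Ω] {K : RatFunc ℝ} {p m : ℕ}
    (r : Realization K p m) (W : ℕ → Ω → ℝ) (μ : Measure Ω) (P : Matrix (Fin m) (Fin m) ℝ)
    (N : Fin m → ℕ) (n : ℕ) {b : ℝ} (hb : 0 ≤ b)
    (h : ∀ j : (i : Fin m) → Fin (N i), μ.real {ω |
      decode P N (r.estimate (messagePoint P N j) (fun k => W k ω) n) ≠ fun i => (j i : ℕ)} ≤ b) :
    errorProb r W μ P N n ≤ b := by
  rw [errorProb]
  refine div_le_of_le_mul₀ (Nat.cast_nonneg _) hb ?_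
  refine (Finset.sum_le_sum fun j _ => h j).trans (le_of_eq ?_)
  rw [Finset.sum_const, Finset.card_univ, Fintype.card_pi, nsmul_eq_mul, mul_comm]
  simp

section Tail

variable {Ω : Type*} [MeasurableSpace Ω] {μ : Measure Ω} [IsProbabilityMeasure μ]
  {H : RatFunc ℝ} {W : ℕ → Ω → ℝ}

/-- The marginals of the noise have a common Gaussian tail. -/
lemma IsStationaryGaussianNoise.exists_tail_le (hW : IsStationaryGaussianNoise H W μ) :
    ∃ s : ℝ, 0 < s ∧ ∀ (l : ℕ) (t : ℝ), 0 ≤ t →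
      μ.real {ω | t ≤ |W l ω|} ≤ 2 * Real.exp (-t ^ 2 / s) := by
  have hvar : ∀ l, variance (W l) μ = variance (W 0) μ := by
    intro l
    have hm := fun l => (hW.gaussian.hasGaussianLaw_eval l).aemeasurable
    rw [← covariance_self (hm l), ← covariance_self (hm 0), hW.cov_eq, hW.cov_eq]
    simp
  set v : NNReal := (variance (W 0) μ).toNNReal with hv
  have hmap : ∀ l, μ.map (W l) = gaussianReal 0 v := by
    intro l
    rw [(hW.gaussian.hasGaussianLaw_eval l).map_eq_gaussianReal, hW.mean_zero, hvar, hv]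
  -- The parameter `v + 1` instead of `v` keeps the tail constant positive when the noise is
  -- degenerate.
  have hsub : ∀ l, HasSubgaussianMGF (W l) (v + 1) μ := by
    intro l
    refine ⟨fun t => ?_, fun t => ?_⟩
    · rw [← mgf_pos_iff, mgf_gaussianReal (hmap l)]
      exact Real.exp_pos _
    · rw [mgf_gaussianReal (hmap l)]
      refine Real.exp_le_exp.2 ?_
      push_cast
      nlinarith [sq_nonneg t]
  refine ⟨2 * ((v + 1 : NNReal) : ℝ), by positivity, fun l t ht => ?_⟩
  have hsubset : {ω | t ≤ |W l ω|} ⊆ {ω | t ≤ W l ω} ∪ {ω | t ≤ (-W l) ω} := by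
    intro ω hω
    rcases le_abs.1 (show t ≤ |W l ω| from hω) with h | h
    · exact Or.inl h
    · exact Or.inr h
  calc μ.real {ω | t ≤ |W l ω|} ≤ μ.real {ω | t ≤ W l ω} + μ.real {ω | t ≤ (-W l) ω} :=
        (measureReal_mono hsubset).trans (measureReal_union_le _ _)
    _ ≤ _ := by
        rw [two_mul (Real.exp _)]
        exact add_le_add ((hsub l).measure_ge_le ht) ((hsub l).neg.measure_ge_le ht)

end Tail

lemma measureReal_exists_le {Ω : Type*} [MeasurableSpace Ω] {μ : Measure Ω} {W : ℕ → Ω → ℝ} {s : ℝ}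
    (hs : ∀ (l : ℕ) (t : ℝ), 0 ≤ t → μ.real {ω | t ≤ |W l ω|} ≤ 2 * Real.exp (-t ^ 2 / s))
    (n : ℕ) {t : ℝ} (ht : 0 ≤ t) :
    μ.real {ω | ∃ l < n, t ≤ |W l ω|} ≤ n * (2 * Real.exp (-t ^ 2 / s)) := by
  have h1 : {ω | ∃ l < n, t ≤ |W l ω|} = ⋃ l ∈ Finset.range n, {ω | t ≤ |W l ω|} := by
    ext ω; simp
  rw [h1]
  refine (measureReal_biUnion_finset_le _ _).trans ?_
  refine (Finset.sum_le_sum fun l _ => hs l t ht).trans (le_of_eq ?_)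
  rw [Finset.sum_const, Finset.card_range, nsmul_eq_mul]

/-- Replacing `τ²ⁿ` by `τⁿ` in the exponent still leaves enough: half of `τⁿ / s` absorbs the factor
`2n`, and the other half gives `a = 1 / (2s)`, `b = log τ`. -/
lemma eventually_mul_exp_le {s τ : ℝ} (hs : 0 < s) (hτ : 1 < τ) :
    ∃ a : ℝ, 0 < a ∧ ∃ b : ℝ, 0 < b ∧ ∀ᶠ n : ℕ in atTop,
      (n : ℝ) * (2 * Real.exp (-(τ ^ n) ^ 2 / s)) ≤ Real.exp (-(a * Real.exp (b * n))) := by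
  have hlog : 0 < Real.log τ := Real.log_pos hτ
  refine ⟨1 / (2 * s), by positivity, Real.log τ, hlog, ?_⟩
  have h1 : Tendsto (fun n : ℕ => (n : ℝ) ^ 1 / τ ^ n) atTop (nhds 0) :=
    tendsto_pow_const_div_const_pow_of_one_lt 1 hτ
  have h2 := (tendsto_order.1 h1).2 (1 / (4 * s)) (by positivity)
  filter_upwards [h2] with n hn
  have hτn : 1 ≤ τ ^ n := one_le_pow₀ hτ.le
  have hexp : Real.exp (Real.log τ * n) = τ ^ n := by
    rw [mul_comm, Real.exp_nat_mul, Real.exp_log (by linarith)]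
  rw [hexp]
  rw [pow_one, div_lt_div_iff₀ (by linarith) (by positivity), one_mul] at hn
  have h3 : 2 * (n : ℝ) ≤ Real.exp (τ ^ n / (2 * s)) := by
    refine le_trans ?_ (Real.add_one_le_exp _)
    have : 2 * (n : ℝ) ≤ τ ^ n / (2 * s) := by
      rw [le_div_iff₀ (by positivity)]; linarith
    linarith
  calc (n : ℝ) * (2 * Real.exp (-(τ ^ n) ^ 2 / s))
      = 2 * (n : ℝ) * Real.exp (-(τ ^ n) ^ 2 / s) := by ring
    _ ≤ Real.exp (τ ^ n / (2 * s)) * Real.exp (-(τ ^ n) / s) := by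
        gcongr
        nlinarith
    _ = Real.exp (-(1 / (2 * s) * τ ^ n)) := by
        rw [← Real.exp_add]
        congr 1
        field_simp
        ring

/-! ### Constellations -/

/-- The number `⌈β ^ n⌉` of cells in a direction. -/
noncomputable def cellCount {m : ℕ} (β : Fin m → ℝ) (n : ℕ) (i : Fin m) : ℕ := ⌈β i ^ n⌉₊

/-- Rounding up at most doubles `βⁿ` once `βⁿ > 1`; otherwise there is a single cell, the
exceptional case of `decode_eq`. -/
lemma cellCount_eq_one_or {m : ℕ} {β : Fin m → ℝ} (hβ : ∀ i, 0 < β i) (n : ℕ) (i : Fin m) :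
    cellCount β n i = 1 ∨ (cellCount β n i : ℝ) ≤ 2 * β i ^ n := by
  rcases le_or_gt (β i ^ n) 1 with h | h
  · left
    rw [cellCount, Nat.ceil_eq_iff one_ne_zero]
    simpa using ⟨pow_pos (hβ i) n, h⟩
  · right
    have := Nat.ceil_lt_add_one (pow_pos (hβ i) n).le
    rw [cellCount]
    linarith

lemma pow_prod_le_prod_cellCount {m : ℕ} {β : Fin m → ℝ} (hβ : ∀ i, 0 < β i) (n : ℕ) :
    (∏ i, β i) ^ n ≤ ((∏ i, cellCount β n i : ℕ) : ℝ) := by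
  rw [← Finset.prod_pow, Nat.cast_prod]
  exact Finset.prod_le_prod (fun i _ => (pow_pos (hβ i) n).le) fun i _ => Nat.le_ceil _

namespace Realization

variable {Q H : RatFunc ℝ} {p m : ℕ} {Ω : Type*} [MeasurableSpace Ω] {μ : Measure Ω}
  [IsProbabilityMeasure μ] {W : ℕ → Ω → ℝ}

/-- If each direction carries its number of cells at a rate below the one at which the estimation
error in that direction decays, the error probability decays doubly exponentially. -/
lemma exists_errorProb_le (hQs : IsStable Q) (hQ : IsStrictlyProper Q)
    (hW : IsStationaryGaussianNoise H W μ) (r : Realization (controller Q) p m)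
    (P : Matrix (Fin m) (Fin m) ℝ) (hP : IsUnit P.det) (β ρ : Fin m → ℝ) {τ : ℝ} (hτ : 1 < τ)
    (hβ : ∀ i, 0 < β i) (hβρ : ∀ i, β i * ρ i * τ ^ 2 ≤ 1)
    (hρ : ∀ i, 0 ≤ ρ i ∧ ∃ C : ℝ, 0 ≤ C ∧ ∀ n j, |(P⁻¹ * r.Au⁻¹ ^ n) i j| ≤ C * ρ i ^ n) :
    ∃ a : ℝ, 0 < a ∧ ∃ b : ℝ, 0 < b ∧ ∀ᶠ n : ℕ in atTop,
      errorProb r W μ P (cellCount β n) n ≤ Real.exp (-(a * Real.exp (b * n))) := by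
  obtain ⟨s, hs0, hs⟩ := hW.exists_tail_le
  obtain ⟨a, ha, b, hb, hab⟩ := eventually_mul_exp_le hs0 hτ
  refine ⟨a, ha, b, hb, ?_⟩
  obtain ⟨M, hM0, hM⟩ := r.exists_abs_loopState_le hQs hQ (∑ i, ∑ l, |P i l|)
  choose hρ0 C hC0 hC using hρ
  set D := ∑ i, C i with hD
  have hD0 : 0 ≤ D := Finset.sum_nonneg fun i _ => hC0 i
  have hCD : ∀ i, C i ≤ D := fun i => Finset.single_le_sum (fun i _ => hC0 i) (Finset.mem_univ i)
  have hlarge : ∀ᶠ n : ℕ in atTop, 8 * (D * (m * M)) < τ ^ n :=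
    (tendsto_pow_atTop_atTop_of_one_lt hτ).eventually_gt_atTop _
  filter_upwards [hab, hlarge] with n hn1 hn2
  refine le_trans (errorProb_le r W μ P _ n (by positivity) fun j => ?_) hn1
  refine (measureReal_mono ?_).trans (measureReal_exists_le hs n (t := τ ^ n) (by positivity))
  intro ω hω
  -- If no noise sample before time `n` reaches `τⁿ`, every coordinate is decoded correctly.
  by_contra hnot
  have hw : ∀ l < n, |W l ω| ≤ τ ^ n := fun l hl => by
    by_contra! h
    exact hnot ⟨l, hl, h.le⟩
  refine hω (decode_eq P _ j _ fun i => ?_)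
  refine (cellCount_eq_one_or hβ n i).imp_right fun hN => ?_
  have hτn : 1 ≤ τ ^ n := one_le_pow₀ hτ.le
  set x₀ := messagePoint P (cellCount β n) j with hx₀
  set ξ : Fin m → ℝ := fun i => r.loopState x₀ (fun k => W k ω) n (Sum.inr i) with hξ
  have hξle : ∑ l, |ξ l| ≤ m * (M * (2 * τ ^ n)) := by
    calc ∑ l, |ξ l| ≤ ∑ _l : Fin m, M * (1 + τ ^ n) :=
          Finset.sum_le_sum fun l _ => hM x₀ _ n (τ ^ n) (by positivity)
            (sum_abs_messagePoint_le P _ j) hw _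
      _ = m * (M * (1 + τ ^ n)) := by simp
      _ ≤ m * (M * (2 * τ ^ n)) := by gcongr; linarith
  have herr : (P⁻¹ *ᵥ r.estimate x₀ (fun k => W k ω) n) i -
      (((j i : ℕ) : ℝ) + 1 / 2) / (cellCount β n i : ℝ) = -((P⁻¹ * r.Au⁻¹ ^ n) *ᵥ ξ) i := by
    have hcell : P⁻¹ *ᵥ x₀ = fun i => (((j i : ℕ) : ℝ) + 1 / 2) / (cellCount β n i : ℝ) := by
      rw [hx₀, messagePoint, Matrix.mulVec_mulVec, Matrix.nonsing_inv_mul _ hP, Matrix.one_mulVec]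
    rw [estimate_eq, Matrix.mulVec_sub, Matrix.mulVec_mulVec, hcell, Pi.sub_apply, sub_sub_cancel_left]
  rw [herr, abs_neg]
  have h1 : |((P⁻¹ * r.Au⁻¹ ^ n) *ᵥ ξ) i| ≤ D * ρ i ^ n * (m * (M * (2 * τ ^ n))) := by
    calc |((P⁻¹ * r.Au⁻¹ ^ n) *ᵥ ξ) i| ≤ ∑ l, |(P⁻¹ * r.Au⁻¹ ^ n) i l| * |ξ l| := by
          rw [Matrix.mulVec, dotProduct]
          refine (Finset.abs_sum_le_sum_abs _ _).trans (le_of_eq ?_)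
          simp_rw [abs_mul]
      _ ≤ ∑ l, D * ρ i ^ n * |ξ l| := by
          refine Finset.sum_le_sum fun l _ => mul_le_mul_of_nonneg_right ?_ (abs_nonneg _)
          exact (hC i n l).trans (mul_le_mul_of_nonneg_right (hCD i) (pow_nonneg (hρ0 i) n))
      _ ≤ D * ρ i ^ n * (m * (M * (2 * τ ^ n))) := by
          rw [← Finset.mul_sum]
          exact mul_le_mul_of_nonneg_left hξle (mul_nonneg hD0 (pow_nonneg (hρ0 i) n))
  have h2 : β i ^ n * ρ i ^ n * (τ ^ n) ^ 2 ≤ 1 := by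
    have := pow_le_one₀ (n := n) (by have := hρ0 i; have := (hβ i).le; positivity) (hβρ i)
    calc β i ^ n * ρ i ^ n * (τ ^ n) ^ 2 = (β i * ρ i * τ ^ 2) ^ n := by ring
      _ ≤ 1 := this
  have hρn : 0 ≤ ρ i ^ n := pow_nonneg (hρ0 i) n
  have hβn : 0 < β i ^ n := pow_pos (hβ i) n
  have hτ0 : 0 < τ ^ n := by linarith
  -- Of the two factors `τⁿ` granted by `hβρ`, one pays for the size of the noise and the other
  -- outgrows the constant `8 D m M`.
  refine lt_of_mul_lt_mul_right ?_ hτ0.le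
  calc |((P⁻¹ * r.Au⁻¹ ^ n) *ᵥ ξ) i| * (2 * cellCount β n i) * τ ^ n
      ≤ D * ρ i ^ n * (m * (M * (2 * τ ^ n))) * (2 * (2 * β i ^ n)) * τ ^ n := by gcongr
    _ = 8 * (D * (m * M)) * (β i ^ n * ρ i ^ n * (τ ^ n) ^ 2) := by ring
    _ ≤ 8 * (D * (m * M)) * 1 := by gcongr
    _ < 1 * τ ^ n := by linarith

/-- Reliability at all rates below the sum of the logarithms of the unstable modes. -/
lemma exists_constellations (hQs : IsStable Q) (hQ : IsStrictlyProper Q)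
    (hW : IsStationaryGaussianNoise H W μ) (r : Realization (controller Q) p m) :
    ∃ P : Matrix (Fin m) (Fin m) ℝ, IsUnit P.det ∧ ∀ R : ℝ, R < r.rate →
      ∃ N : ℕ → Fin m → ℕ,
        (∀ n : ℕ, (2 : ℝ) ^ ((n : ℝ) * R) ≤ ((∏ i, N n i : ℕ) : ℝ)) ∧
        ∃ a : ℝ, 0 < a ∧ ∃ b : ℝ, 0 < b ∧ ∀ᶠ n : ℕ in atTop,
          errorProb r W μ P (N n) n ≤ Real.exp (-(a * Real.exp (b * n))) := by
  obtain ⟨P, q, hP, hq, hsum, hrow⟩ := exists_coordinates_inv_pow_le r.Au r.eigenvalues_ne_zero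
  have hq0 : ∀ i, 0 < q i := fun i => by
    obtain ⟨z, hz, hqz⟩ := hq i
    rw [hqz]
    linarith [r.unstable z hz]
  refine ⟨P, hP, fun R hR => ?_⟩
  -- Each of the `m` directions will give up `4δ` bits per use; dividing by `m + 1` covers `m = 0`.
  obtain ⟨δ, hδ, hmδ⟩ : ∃ δ : ℝ, 0 < δ ∧ (m : ℝ) * (4 * δ) ≤ r.rate - R := by
    refine ⟨(r.rate - R) / (4 * (m + 1)), div_pos (by linarith) (by positivity), ?_⟩
    have h0 : 0 < r.rate - R := by linarith
    have h1 : (m : ℝ) * (4 * ((r.rate - R) / (4 * (m + 1)))) = (r.rate - R) * (m / (m + 1)) := by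
      field_simp
    rw [h1]
    refine mul_le_of_le_one_right h0.le ?_
    rw [div_le_one (by positivity)]
    linarith
  set τ : ℝ := (2 : ℝ) ^ δ with hτ
  have hτ1 : 1 < τ := Real.one_lt_rpow one_lt_two hδ
  have hτ0 : 0 < τ := by linarith
  -- One factor `τ` pays for the decay rate `τ / q i`, which must exceed `1 / q i`; two pay for the
  -- `τ ^ 2` in `exists_errorProb_le`; one is spare.
  set β : Fin m → ℝ := fun i => q i / τ ^ 4 with hβ
  have hβ0 : ∀ i, 0 < β i := fun i => div_pos (hq0 i) (by positivity)
  refine ⟨cellCount β, fun n => ?_, ?_⟩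
  · refine le_trans ?_ (pow_prod_le_prod_cellCount hβ0 n)
    rw [mul_comm, Real.rpow_mul two_pos.le, Real.rpow_natCast]
    refine pow_le_pow_left₀ (by positivity) ?_ n
    have hpos : 0 < ∏ i, β i := Finset.prod_pos fun i _ => hβ0 i
    rw [← Real.le_logb_iff_rpow_le one_lt_two hpos, Real.logb_prod _ _ fun i _ => (hβ0 i).ne']
    have h1 : ∀ i, Real.logb 2 (β i) = Real.logb 2 (q i) - 4 * δ := by
      intro i
      rw [hβ, Real.logb_div (hq0 i).ne' (by positivity), Real.logb_pow, hτ,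
        Real.logb_rpow two_pos (by norm_num)]
      norm_num
    simp_rw [h1]
    rw [Finset.sum_sub_distrib, hsum (Real.logb 2), ← Realization.rate]
    simp only [Finset.sum_const, Finset.card_univ, Fintype.card_fin, nsmul_eq_mul]
    linarith
  · refine r.exists_errorProb_le hQs hQ hW P hP β (fun i => (q i)⁻¹ * τ) hτ1 hβ0 (fun i => ?_)
      fun i => ⟨mul_nonneg (inv_nonneg.2 (hq0 i).le) hτ0.le, hrow i _ ?_⟩
    · have h1 : β i * ((q i)⁻¹ * τ) * τ ^ 2 = τ⁻¹ := by
        have := (hq0 i).ne'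
        simp only [hβ]
        field_simp
      rw [h1]
      exact inv_le_one_of_one_le₀ hτ1.le
    · exact lt_mul_of_one_lt_right (inv_pos.2 (hq0 i)) hτ1

end Realization

end FeedbackCode

theorem theorem1 (Q H : RatFunc ℝ)
    (hQ : FeedbackCode.IsStable Q) (hQc : FeedbackCode.IsStrictlyProper Q)
    (hH : FeedbackCode.IsStable H) (hHp : FeedbackCode.IsProper H)
    {Ω : Type*} [MeasurableSpace Ω] (μ : Measure Ω) [IsProbabilityMeasure μ]
    (W : ℕ → Ω → ℝ) (hW : FeedbackCode.IsStationaryGaussianNoise H W μ) :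
    (∃ p m : ℕ, Nonempty (FeedbackCode.Realization (FeedbackCode.controller Q) p m)) ∧
    ∀ (p m : ℕ) (r : FeedbackCode.Realization (FeedbackCode.controller Q) p m),
      (IntervalIntegrable (fun θ : ℝ => Real.logb 2 ‖1 + FeedbackCode.freqResponse Q θ‖)
          volume (-Real.pi) Real.pi ∧
        (1 / (2 * Real.pi)) *
          ∫ θ in (-Real.pi)..Real.pi, Real.logb 2 ‖1 + FeedbackCode.freqResponse Q θ‖ = r.rate) ∧
      ∃ P : Matrix (Fin m) (Fin m) ℝ, IsUnit P.det ∧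
        ∀ R : ℝ, R < r.rate →
          ∃ N : ℕ → Fin m → ℕ,
            (∀ n : ℕ, (2 : ℝ) ^ ((n : ℝ) * R) ≤ ((∏ i, N n i : ℕ) : ℝ)) ∧
            (∃ a : ℝ, 0 < a ∧ ∃ b : ℝ, 0 < b ∧ ∀ᶠ n : ℕ in atTop,
              FeedbackCode.errorProb r W μ P (N n) n ≤ Real.exp (-(a * Real.exp (b * n)))) ∧
            (∀ ε : ℝ, 0 < ε → ∀ᶠ n : ℕ in atTop, ∀ j : (i : Fin m) → Fin (N n i),
              |FeedbackCode.averagePower r W μ P (N n) j n -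
                (1 / (2 * Real.pi)) * ∫ θ in (-Real.pi)..Real.pi,
                  ‖FeedbackCode.freqResponse Q θ‖ ^ 2 * FeedbackCode.spectralDensity H θ| < ε) := by
  refine ⟨FeedbackCode.exists_realization hQc, fun p m r =>
    ⟨FeedbackCode.bode_integral hQ hQc r, ?_⟩⟩
  obtain ⟨P, hP, hrate⟩ := r.exists_constellations hQ hQc hW
  refine ⟨P, hP, fun R hR => ?_⟩
  obtain ⟨N, hN, herr⟩ := hrate R hR
  -- The power limit holds for every sequence of constellations, so the one chosen for reliability
  -- serves.
  exact ⟨N, hN, herr, fun ε hε =>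
    FeedbackCode.eventually_abs_averagePower_sub_lt hQ hQc hH hW r P N hε⟩
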